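/- **Diagrams.** All virtual link diagrams are oriented, with components labelled $1,\dots,n$, and are recorded by their Gauss diagrams: $n$ labelled oriented circles, with one signed arrow for every classical crossing, directed from its over-crossing point (tail) to its under-crossing point (head). Virtual crossings are not recorded, so planar isotopies and detour moves act trivially. Two diagrams are *equivalent* if they are related by a finite sequence of Reidemeister moves (and isomorphisms of Gauss diagrams), respecting the labels and orientations of the components. A *short arc* of a diagram is a part of a component between consecutive classical crossing points; a component without classical crossings is a single short arc. Let $L,L'$ be diagrams with $n+1$ components, the last of which is called $\omega$. They are *semi-welded equivalent*, $L\leftrightharpoons_{sw}L'$, if they are related by a finite sequence of Reidemeister moves, isomorphisms of Gauss diagrams, and $\omega$-over-crossings-commute moves, each of which exchanges two adjacent arrow tails lying on $\omega$. **The $\mathrm{Zh}^{\mathrm{op}}$-construction.** Let $D$ be an $n$-component diagram. Draw each classical crossing $x$ of $D$, of sign $\varepsilon_x$, with both strands going upwards, and choose one of its sides, left or right. On the chosen side, an added component $\omega$ over-crosses once each of the two short arcs of $D$ at $x$ on that side: the incoming one just before $x$ and the outgoing one just after $x$. In $\mathrm{Zh}(D)=D\cup\omega$ the added crossing has sign $-\varepsilon_x$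 on the over-strand of $x$ and $+\varepsilon_x$ on the under-strand of $x$. The over-crossing points are joined in an arbitrary order to form the single circle $\omega$, and there are no further classical crossings with $\omega$. The diagram $\mathrm{Zh}^{\mathrm{op}}(D)=D\cup\omega^{\mathrm{op}}$ is obtained from $\mathrm{Zh}(D)$ by reversing the orientation of $\omega$, which changes the signs of all added crossings. **Alexander systems.** An *Alexander system* for an $n$-component diagram $D$ is a triple $(D,\gamma,\Gamma)$, where $D\cup\gamma$ is an $(n+1)$-component diagram whose first $n$ components form the diagram $D$, and $\Gamma$ assigns an integer to each short arc of $D\cup\gamma$ lying in $D$, such that 1. at every classical crossing involving $\gamma$, the over-crossing strand lies in $\gamma$ and the under-crossing strand lies in $D$; 2. (a) at every classical crossing of $\gamma$ over $D$ of sign $\varepsilon$, the label of the outgoing short arc of $D$ is the label of the incoming one plus $\varepsilon$; (b) at every classical self-crossing of $D$, drawn with both strands going upwards, there is an integer $m$ such that the two short arcs on the right are labelled $m$ and the two short arcs on the left are labelled $m+1$. **Theorem.** Let $D_0$ and $D_1$ be equivalent $n$-component virtual link diagrams. For every Alexander system $(D_1,\gamma,\Gamma)$ for $D_1$ and every diagram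 $\mathrm{Zh}^{\mathrm{op}}(D_0)$ obtained by any choices in the construction, $$D_1\cup\gamma \;\leftrightharpoons_{sw}\; \mathrm{Zh}^{\mathrm{op}}(D_0).$$ In particular, $D_1\cup\gamma\leftrightharpoons_{sw}D_1\cup\gamma'$ for any two Alexander systems $(D_1,\gamma,\Gamma)$ and $(D_1,\gamma',\Gamma')$ for the same diagram $D_1$. -/

import Mathlib

/-- An oriented virtual link diagram with components labelled by `Fin n`, recorded by its Gauss
diagram.  `Arrow` is the set of classical crossings and `sign` gives the crossing signs.  The arrow
`a` has a tail `(a, true)`, on the over-crossing strand, and a head `(a, false)`, on the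
under-crossing strand.  `word i` lists the arrow endpoints met along the `i`-th oriented circle,
read from some base point.  Virtual crossings are not recorded. -/
structure GaussDiagram (n : ℕ) where
  Arrow : Type
  sign : Arrow → ℤˣ
  word : Fin n → List (Arrow × Bool)
  nodup : ∀ i, (word i).Nodup
  unique : ∀ e : Arrow × Bool, ∃! i, e ∈ word i

namespace GaussDiagram

variable {n : ℕ}

/-- The tail of an arrow: its endpoint on the over-crossing strand. -/
abbrev tail {X : Type} (a : X) : X × Bool := (a, true)

/-- The head of an arrow: its endpoint on the under-crossing strand. -/
abbrev head {X : Type} (a : X) : X × Bool := (a, false)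

/-- Gauss diagrams up to renaming the arrows and moving the base points, i.e. up to
orientation-preserving diffeomorphisms of the (labelled) circles. -/
def Iso (D D' : GaussDiagram n) : Prop :=
  ∃ f : D.Arrow ≃ D'.Arrow, (∀ a, D'.sign (f a) = D.sign a) ∧
    ∀ i, (D.word i).map (Prod.map f id) ~r D'.word i

/-- The endpoint `f` comes immediately after the endpoint `e` on the `i`-th oriented circle. -/
def Next (D : GaussDiagram n) (i : Fin n) (e f : D.Arrow × Bool) : Prop :=
  ∃ l, D.word i ~r e :: f :: l

/-- `e` and `f` are neighbours on some circle; `f` follows `e` if `s = 1`, and `e` follows `f` if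
`s = -1`. -/
def Consecutive (D : GaussDiagram n) (s : ℤˣ) (e f : D.Arrow × Bool) : Prop :=
  ∃ i, (s = 1 ∧ D.Next i e f) ∨ (s = -1 ∧ D.Next i f e)

section Lists

variable {X : Type}

open Classical in
/-- Keep in a word only the endpoints of the arrows satisfying `p`. -/
noncomputable def keep (p : X → Prop) (w : List (X × Bool)) : List ({a // p a} × Bool) :=
  w.filterMap fun e => if h : p e.1 then some (⟨e.1, h⟩, e.2) else none

theorem mem_keep {p : X → Prop} {w : List (X × Bool)} {e : {a // p a} × Bool} :
    e ∈ keep p w ↔ ((e.1 : X), e.2) ∈ w := by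
  obtain ⟨⟨a, ha⟩, b⟩ := e
  simp only [keep, List.mem_filterMap]
  constructor
  · rintro ⟨x, hx, h⟩
    split_ifs at h with hp
    · simp only [Option.some.injEq, Prod.mk.injEq, Subtype.mk.injEq] at h
      obtain ⟨h1, h2⟩ := h
      subst h1 h2
      exact hx
  · intro h
    exact ⟨(a, b), h, by simp [ha]⟩

theorem nodup_keep (p : X → Prop) {w : List (X × Bool)} (hw : w.Nodup) : (keep p w).Nodup := by
  refine List.Nodup.filterMap ?_ hw
  intro x y z hx hy
  simp only [Option.mem_def] at hx hy
  split_ifs at hx with h1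
  split_ifs at hy with h2
  simp only [Option.some.injEq] at hx hy
  rw [← hy] at hx
  simp only [Prod.mk.injEq, Subtype.mk.injEq] at hx
  exact Prod.ext hx.1 hx.2

end Lists

/-- Delete the arrows that do not satisfy `p`. -/
noncomputable def restrict (D : GaussDiagram n) (p : D.Arrow → Prop) : GaussDiagram n where
  Arrow := {a // p a}
  sign a := D.sign a
  word i := keep p (D.word i)
  nodup i := nodup_keep p (D.nodup i)
  unique e := by simpa only [mem_keep] using D.unique ((e.1 : D.Arrow), e.2)

/-- Let the arrow endpoints change places according to a permutation `σ`. -/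
def permute (D : GaussDiagram n) (σ : Equiv.Perm (D.Arrow × Bool)) : GaussDiagram n where
  Arrow := D.Arrow
  sign := D.sign
  word i := (D.word i).map σ
  nodup i := (D.nodup i).map σ.injective
  unique e := by
    have h : ∀ i, e ∈ (D.word i).map σ ↔ σ.symm e ∈ D.word i := by
      intro i
      rw [List.mem_map]
      constructor
      · rintro ⟨x, hx, rfl⟩
        simpa using hx
      · exact fun hx => ⟨_, hx, by simp⟩
    simpa only [h] using D.unique (σ.symm e)

/-- First Reidemeister move: remove an arrow whose two endpoints are neighbours. -/
def Omega1 (D D' : GaussDiagram n) : Prop :=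
  ∃ (a : D.Arrow) (i : Fin n),
    (D.Next i (tail a) (head a) ∨ D.Next i (head a) (tail a)) ∧
    D'.Iso (D.restrict fun x => x ≠ a)

/-- Second Reidemeister move: remove two arrows of opposite signs whose tails are neighbours and
whose heads are neighbours. -/
def Omega2 (D D' : GaussDiagram n) : Prop :=
  ∃ (a b : D.Arrow) (i j : Fin n), D.sign a = -D.sign b ∧
    D.Next i (tail a) (tail b) ∧
    (D.Next j (head a) (head b) ∨ D.Next j (head b) (head a)) ∧
    D'.Iso (D.restrict fun x => x ≠ a ∧ x ≠ b)

open Classical in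
/-- Third Reidemeister move.  Three strands (top, middle, bottom) form a triangle with the
crossings `a` (top over middle), `b` (top over bottom) and `c` (middle over bottom).  The move
reverses the order of the two crossings on each of the three strands and keeps all signs.
If `t`, `m`, `r` are the directions of the three strands in the plane then the signs are those of
`det (t, m)`, `det (t, r)`, `det (m, r)`, and the orders of the crossings along the strands are
those of a planar triangle exactly if they are given as below by these signs and by `δ`, which
says on which side of the crossing `c` the top strand passes. -/
def Omega3 (D D' : GaussDiagram n) : Prop :=
  ∃ (a b c : D.Arrow) (δ : ℤˣ), a ≠ b ∧ a ≠ c ∧ b ≠ c ∧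
    D.Consecutive (δ * D.sign a * D.sign b * D.sign c) (tail a) (tail b) ∧
    D.Consecutive (δ * D.sign a) (head a) (tail c) ∧
    D.Consecutive (δ * D.sign b) (head b) (head c) ∧
    D'.Iso (D.permute (Equiv.swap (tail a) (tail b) * Equiv.swap (head a) (tail c) *
      Equiv.swap (head b) (head c)))

/-- One Reidemeister move, or an isomorphism of Gauss diagrams.  (Planar isotopies and detour
moves do not change the Gauss diagram.) -/
inductive Move (D D' : GaussDiagram n) : Prop
  | iso (h : D.Iso D')
  | omega1 (h : D.Omega1 D')
  | omega2 (h : D.Omega2 D')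
  | omega3 (h : D.Omega3 D')

/-- Equivalence of virtual link diagrams (with ordered, oriented components). -/
def Equivalent (D D' : GaussDiagram n) : Prop := Relation.EqvGen Move D D'

open Classical in
/-- The `ω`-over-crossings-commute move: exchange two neighbouring tails on the last component. -/
def OmegaOCC (L L' : GaussDiagram (n + 1)) : Prop :=
  ∃ a b : L.Arrow, L.Next (Fin.last n) (tail a) (tail b) ∧
    L'.Iso (L.permute (Equiv.swap (tail a) (tail b)))

/-- Semi-welded equivalence of diagrams with `n + 1` components, the last one being `ω`. -/
def SemiWelded (L L' : GaussDiagram (n + 1)) : Prop :=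
  Relation.EqvGen (fun M M' => Move M M' ∨ OmegaOCC M M') L L'

/-- The crossing `a` involves the last component. -/
def Touches (L : GaussDiagram (n + 1)) (a : L.Arrow) : Prop :=
  tail a ∈ L.word (Fin.last n) ∨ head a ∈ L.word (Fin.last n)

/-- The sublink consisting of the first `n` components. -/
noncomputable def eraseLast (L : GaussDiagram (n + 1)) : GaussDiagram n where
  Arrow := {a // ¬ L.Touches a}
  sign a := L.sign a
  word i := keep (fun a => ¬ L.Touches a) (L.word i.castSucc)
  nodup i := nodup_keep _ (L.nodup _)
  unique e := by
    obtain ⟨⟨a, ha⟩, b⟩ := e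
    simp only [mem_keep]
    obtain ⟨i, hi, hu⟩ := L.unique (a, b)
    induction i using Fin.lastCases with
    | last =>
      refine absurd ?_ ha
      cases b
      · exact Or.inr hi
      · exact Or.inl hi
    | cast i => exact ⟨i, hi, fun j hj => Fin.castSucc_injective n (hu _ hj)⟩

open Classical in
/-- Reverse the orientation of the last component.  This changes the sign of a crossing once for
each of its two strands that belongs to the last component. -/
noncomputable def reverseLast (L : GaussDiagram (n + 1)) : GaussDiagram (n + 1) where
  Arrow := L.Arrow
  sign a := (if tail a ∈ L.word (Fin.last n) then -1 else 1) *
    (if head a ∈ L.word (Fin.last n) then -1 else 1) * L.sign a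
  word i := if i = Fin.last n then (L.word i).reverse else L.word i
  nodup i := by
    split_ifs
    · exact List.nodup_reverse.mpr (L.nodup i)
    · exact L.nodup i
  unique e := by
    have h : ∀ i, e ∈ (if i = Fin.last n then (L.word i).reverse else L.word i) ↔
        e ∈ L.word i := by
      intro i
      split_ifs
      · exact List.mem_reverse
      · exact Iff.rfl
    simpa only [h] using L.unique e

/-! ### Short arcs and Alexander systems -/

/-- The positions of the arrow endpoints on the circles. -/
abbrev Position (D : GaussDiagram n) : Type := Σ i : Fin n, Fin (D.word i).length

/-- The arrow endpoint at a given position. -/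
def endpoint (D : GaussDiagram n) (p : D.Position) : D.Arrow × Bool := (D.word p.1).get p.2

/-- The short arcs: a circle with `k ≥ 1` arrow endpoints is cut by them into `k` short arcs, the
`j`-th of which ends at the `j`-th endpoint; a circle without endpoints is one short arc. -/
abbrev ShortArc (D : GaussDiagram n) : Type := Σ i : Fin n, Fin (max (D.word i).length 1)

/-- The short arc that ends at a given position. -/
def before (D : GaussDiagram n) (p : D.Position) : D.ShortArc :=
  ⟨p.1, ⟨p.2, lt_max_of_lt_left p.2.isLt⟩⟩

/-- The short arc that starts at a given position. -/
def after (D : GaussDiagram n) (p : D.Position) : D.ShortArc :=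
  ⟨p.1, ⟨(p.2 + 1) % (D.word p.1).length,
    lt_max_of_lt_left (Nat.mod_lt _ (Nat.zero_lt_of_lt p.2.isLt))⟩⟩

/-- The short arcs of `L = D ∪ γ` that lie in the first `n` components `D`. -/
abbrev BaseArc (L : GaussDiagram (n + 1)) : Type := {s : L.ShortArc // s.1 ≠ Fin.last n}

/-- The incoming short arc at a position on one of the first `n` components. -/
def baseBefore (L : GaussDiagram (n + 1)) (p : L.Position) (hp : p.1 ≠ Fin.last n) : L.BaseArc :=
  ⟨L.before p, hp⟩

/-- The outgoing short arc at a position on one of the first `n` components. -/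
def baseAfter (L : GaussDiagram (n + 1)) (p : L.Position) (hp : p.1 ≠ Fin.last n) : L.BaseArc :=
  ⟨L.after p, hp⟩

/-- `Γ` is an Alexander sub-numbering.  At a crossing of sign `ε` of the last component over `D`,
the label increases by `ε` along the under-strand.  At a self-crossing of `D`, drawn with both
strands going upwards, the two short arcs on the right carry a label `m` and the two short arcs on
the left the label `m + 1`: the over-strand enters on the left and leaves on the right if the sign
is positive, and vice versa if it is negative. -/
structure IsSubNumbering (L : GaussDiagram (n + 1)) (Γ : L.BaseArc → ℤ) : Prop where
  mixed : ∀ (a : L.Arrow) (q : L.Position) (hq : q.1 ≠ Fin.last n),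
    tail a ∈ L.word (Fin.last n) → L.endpoint q = head a →
      Γ (L.baseAfter q hq) = Γ (L.baseBefore q hq) + (L.sign a : ℤ)
  pos : ∀ (a : L.Arrow) (p q : L.Position) (hp : p.1 ≠ Fin.last n) (hq : q.1 ≠ Fin.last n),
    L.sign a = 1 → L.endpoint p = tail a → L.endpoint q = head a →
      ∃ m : ℤ, Γ (L.baseBefore p hp) = m + 1 ∧ Γ (L.baseAfter p hp) = m ∧
        Γ (L.baseBefore q hq) = m ∧ Γ (L.baseAfter q hq) = m + 1
  neg : ∀ (a : L.Arrow) (p q : L.Position) (hp : p.1 ≠ Fin.last n) (hq : q.1 ≠ Fin.last n),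
    L.sign a = -1 → L.endpoint p = tail a → L.endpoint q = head a →
      ∃ m : ℤ, Γ (L.baseBefore p hp) = m ∧ Γ (L.baseAfter p hp) = m + 1 ∧
        Γ (L.baseBefore q hq) = m + 1 ∧ Γ (L.baseAfter q hq) = m

/-- An Alexander system for `D`: a diagram `D ∪ γ` with `n + 1` components, whose first `n`
components form `D`, such that at every crossing involving the last component `γ` the over-strand
lies in `γ` and the under-strand in `D`, together with an Alexander sub-numbering. -/
structure AlexanderSystem (D : GaussDiagram n) where
  diagram : GaussDiagram (n + 1)
  base : diagram.eraseLast.Iso D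
  crossings : ∀ a, diagram.Touches a →
    tail a ∈ diagram.word (Fin.last n) ∧ head a ∉ diagram.word (Fin.last n)
  label : diagram.BaseArc → ℤ
  isSubNumbering : diagram.IsSubNumbering label

/-! ### The Zh-construction -/

/-- The choices in the Zh-construction: on which side of each crossing of `D` the two small arcs
of `ω` are drawn, and in which order the small arcs are joined to a circle.  There is one small
arc for each of the two strands at each crossing of `D`. -/
structure ZhChoice (D : GaussDiagram n) where
  onRight : D.Arrow → Bool
  order : List (D.Arrow × Bool)
  nodup : order.Nodup
  complete : ∀ e, e ∈ order

/-- With both strands going upwards, the strand `e` of a crossing goes from the left to the right: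
this is the over-strand at a positive and the under-strand at a negative crossing. -/
def LeftToRight (D : GaussDiagram n) (e : D.Arrow × Bool) : Prop :=
  e.2 = true ↔ D.sign e.1 = 1

open Classical in
/-- The neighbourhood of the endpoint `e` in the Zh-diagram.  The small arcs on the right cross the
two right-hand short arcs at the crossing (the outgoing one of the strand that goes from left to
right and the incoming one of the other strand); the small arcs on the left cross the other two. -/
noncomputable def zhLocal (D : GaussDiagram n) (onRight : D.Arrow → Bool) (e : D.Arrow × Bool) :
    List ((D.Arrow ⊕ D.Arrow × Bool) × Bool) :=
  if D.LeftToRight e ↔ onRight e.1 = true then [(Sum.inl e.1, e.2), head (Sum.inr e)]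
  else [head (Sum.inr e), (Sum.inl e.1, e.2)]

theorem mem_zhLocal (D : GaussDiagram n) (r : D.Arrow → Bool) (e : D.Arrow × Bool)
    (x : (D.Arrow ⊕ D.Arrow × Bool) × Bool) :
    x ∈ D.zhLocal r e ↔ x = (Sum.inl e.1, e.2) ∨ x = head (Sum.inr e) := by
  unfold zhLocal
  split_ifs <;> simp [or_comm]

theorem mem_flatMap_inl (D : GaussDiagram n) (r : D.Arrow → Bool) (w : List (D.Arrow × Bool))
    (a : D.Arrow) (b : Bool) : (Sum.inl a, b) ∈ w.flatMap (D.zhLocal r) ↔ (a, b) ∈ w := by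
  simp only [List.mem_flatMap, mem_zhLocal]
  constructor
  · rintro ⟨e, he, h | h⟩
    · simp only [Prod.mk.injEq, Sum.inl.injEq] at h
      obtain ⟨rfl, rfl⟩ := h
      exact he
    · simp at h
  · exact fun h => ⟨_, h, Or.inl rfl⟩

theorem mem_flatMap_inr (D : GaussDiagram n) (r : D.Arrow → Bool) (w : List (D.Arrow × Bool))
    (e : D.Arrow × Bool) (b : Bool) :
    (Sum.inr e, b) ∈ w.flatMap (D.zhLocal r) ↔ b = false ∧ e ∈ w := by
  simp only [List.mem_flatMap, mem_zhLocal]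
  constructor
  · rintro ⟨e', he, h | h⟩
    · simp at h
    · simp only [Prod.mk.injEq, Sum.inr.injEq] at h
      obtain ⟨rfl, rfl⟩ := h
      exact ⟨rfl, he⟩
  · rintro ⟨rfl, h⟩
    exact ⟨_, h, Or.inr rfl⟩

/-- The Zh-construction `D ∪ ω`.  Each endpoint `e` of `D` gives one new arrow `Sum.inr e`, with
its tail on `ω` and its head next to `e`.  At a crossing of `D` of sign `ε`, the new crossing has
sign `-ε` on the over-strand and `ε` on the under-strand. -/
noncomputable def zh (D : GaussDiagram n) (c : ZhChoice D) : GaussDiagram (n + 1) where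
  Arrow := D.Arrow ⊕ D.Arrow × Bool
  sign := Sum.elim D.sign fun e => if e.2 = true then -D.sign e.1 else D.sign e.1
  word := Fin.snoc (α := fun _ => List ((D.Arrow ⊕ D.Arrow × Bool) × Bool))
    (fun i => (D.word i).flatMap (D.zhLocal c.onRight)) (c.order.map fun e => tail (Sum.inr e))
  nodup i := by
    induction i using Fin.lastCases with
    | last =>
      rw [Fin.snoc_last]
      refine c.nodup.map ?_
      intro x y h
      simpa using h
    | cast i =>
      rw [Fin.snoc_castSucc, List.nodup_flatMap]
      refine ⟨fun e _ => ?_, (D.nodup i).imp ?_⟩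
      · unfold zhLocal
        split_ifs <;> simp
      · intro e f hef x hx hy
        rw [mem_zhLocal] at hx hy
        rcases hx with rfl | rfl <;> rcases hy with h | h <;>
          simp only [Prod.mk.injEq, Sum.inl.injEq, Sum.inr.injEq, reduceCtorEq, false_and,
            and_true] at h
        · exact hef (Prod.ext h.1 h.2)
        · exact hef h
  unique x := by
    obtain ⟨a | e, b⟩ := x
    · obtain ⟨i, hi, hu⟩ := D.unique (a, b)
      refine ⟨i.castSucc, ?_, ?_⟩
      · simp only [Fin.snoc_castSucc]
        exact (mem_flatMap_inl D _ _ a b).mpr hi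
      · intro j hj
        induction j using Fin.lastCases with
        | last => simp at hj
        | cast j =>
          simp only [Fin.snoc_castSucc] at hj
          rw [hu j ((mem_flatMap_inl D _ _ a b).mp hj)]
    · cases b
      · obtain ⟨i, hi, hu⟩ := D.unique e
        refine ⟨i.castSucc, ?_, ?_⟩
        · simp only [Fin.snoc_castSucc]
          exact (mem_flatMap_inr D _ _ e false).mpr ⟨rfl, hi⟩
        · intro j hj
          induction j using Fin.lastCases with
          | last => simp at hj
          | cast j =>
            simp only [Fin.snoc_castSucc] at hj
            rw [hu j ((mem_flatMap_inr D _ _ e false).mp hj).2]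
      · refine ⟨Fin.last n, ?_, ?_⟩
        · simpa using c.complete e
        · intro j hj
          induction j using Fin.lastCases with
          | last => rfl
          | cast j =>
            simp only [Fin.snoc_castSucc] at hj
            exact absurd ((mem_flatMap_inr D _ _ e true).mp hj).1 (by simp)

/-- `Zh` with the orientation of the component `ω` reversed. -/
noncomputable def zhOp (D : GaussDiagram n) (c : ZhChoice D) : GaussDiagram (n + 1) :=
  (D.zh c).reverseLast

end GaussDiagram

/-! All crossings of `γ` or `ω` with the other components have their tails on the last circle, and
the commutation move makes the order of these tails irrelevant. Up to semi-welded equivalence such a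
diagram is therefore a system of cyclic words along the first n circles, whose letters are the
endpoints of D and signed marks, a mark being an under-crossing with the last component (`Marked`,
`Realizes.semiWelded`).

Two operations on marks are needed. Neighbouring marks of opposite signs cancel by the second
Reidemeister move (`Marked.sw_cancel`), so a positive mark acts as a unit μ of a monoid (`Reduced`,
`Marked.sw_of_red_eq`). By the third move the last component can be pulled across a crossing c,
which carries a positive mark from before to after both endpoints of c at once (`Marked.sw_slide`).

Give each crossing a an integer t a, the label of its incoming over-strand; the Alexander rule then
fixes its other three labels. The canonical word `canon` replaces each endpoint e by μ^in(e) · e ·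
μ^(-out(e)). A slide changes one t c by 1, so all choices of t are equivalent (`canon_sw_canon`).

In an Alexander system the marks between consecutive endpoints e, f multiply to μ^(in(f) - out(e)),
as in a canonical word. Telescoping around each circle thus conjugates the words of D ∪ γ into
canonical ones (`markPow_mul_red`, `AlexanderSystem.exists_realizes`). The diagram Zh^op(D) realizes
canonical words exactly, with labels 0 and ±1 (`zhOp_realizes`).

It remains to see that the canonical words are invariant under equivalence of D
(`canon_sw_of_equivalent`). For a Reidemeister move, t is chosen so that the labels agree along the
short arcs inside the move. The marks on these arcs cancel (`canon_sw_openBlock`), the move can be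
made in the presence of the last component, and the remaining marks reduce to canonical marks of the
new diagram. -/

namespace GaussDiagram

variable {n : ℕ}

/-! ### Formal properties of isomorphism and semi-welded equivalence. -/

section Isomorphisms

/-- Two diagrams with the same arrows whose words agree up to the choice of base points. -/
theorem Iso.of_isRotated {A : Type} {s : A → ℤˣ} {w w' : Fin n → List (A × Bool)}
    {h₁ : ∀ i, (w i).Nodup} {h₂ : ∀ e, ∃! i, e ∈ w i} {h₁' : ∀ i, (w' i).Nodup}
    {h₂' : ∀ e, ∃! i, e ∈ w' i} (h : ∀ i, w i ~r w' i) :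
    Iso (⟨A, s, w, h₁, h₂⟩ : GaussDiagram n) ⟨A, s, w', h₁', h₂'⟩ :=
  ⟨Equiv.refl _, fun _ => rfl, fun i => by simpa using h i⟩

theorem Iso.refl (D : GaussDiagram n) : D.Iso D :=
  Iso.of_isRotated fun i => List.IsRotated.refl (D.word i)

theorem SemiWelded.refl (L : GaussDiagram (n + 1)) : L.SemiWelded L := Relation.EqvGen.refl L

theorem SemiWelded.symm {L L' : GaussDiagram (n + 1)} (h : L.SemiWelded L') : L'.SemiWelded L :=
  Relation.EqvGen.symm _ _ h

theorem SemiWelded.trans {L L' L'' : GaussDiagram (n + 1)} (h : L.SemiWelded L')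
    (h' : L'.SemiWelded L'') : L.SemiWelded L'' :=
  Relation.EqvGen.trans _ _ _ h h'

theorem SemiWelded.of_move {L L' : GaussDiagram (n + 1)} (h : L.Move L') : L.SemiWelded L' :=
  Relation.EqvGen.rel _ _ (Or.inl h)

theorem SemiWelded.of_omegaOCC {L L' : GaussDiagram (n + 1)} (h : L.OmegaOCC L') :
    L.SemiWelded L' :=
  Relation.EqvGen.rel _ _ (Or.inr h)

end Isomorphisms

/-! ### Irrelevance of the order of tails on the last circle. -/

section Rearranging

/-- Reorder the endpoints on each circle. -/
def rearrange (D : GaussDiagram n) (w : Fin n → List (D.Arrow × Bool))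
    (hw : ∀ i, (w i).Perm (D.word i)) : GaussDiagram n where
  Arrow := D.Arrow
  sign := D.sign
  word := w
  nodup i := (hw i).nodup_iff.mpr (D.nodup i)
  unique e := by simpa only [(hw _).mem_iff] using D.unique e

theorem eq_of_mem_word (D : GaussDiagram n) {e : D.Arrow × Bool} {i j : Fin n}
    (hi : e ∈ D.word i) (hj : e ∈ D.word j) : i = j :=
  (D.unique e).unique hi hj

/-- Reorder the endpoints on the last circle. -/
def setLast (L : GaussDiagram (n + 1)) (w : List (L.Arrow × Bool))
    (hw : w.Perm (L.word (Fin.last n))) : GaussDiagram (n + 1) :=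
  L.rearrange (Function.update L.word (Fin.last n) w) fun i => by
    by_cases hi : i = Fin.last n
    · subst hi; simpa using hw
    · rw [Function.update_of_ne hi]

@[simp] theorem setLast_word_last (L : GaussDiagram (n + 1)) (w : List (L.Arrow × Bool))
    (hw : w.Perm (L.word (Fin.last n))) : (L.setLast w hw).word (Fin.last n) = w :=
  Function.update_self ..

@[simp] theorem setLast_word_castSucc (L : GaussDiagram (n + 1)) (w : List (L.Arrow × Bool))
    (hw : w.Perm (L.word (Fin.last n))) (i : Fin n) :
    (L.setLast w hw).word i.castSucc = L.word i.castSucc :=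
  Function.update_of_ne (Fin.castSucc_lt_last i).ne ..

theorem isRotated_of_eq {X : Type*} {u v : List X} (h : u = v) : u ~r v :=
  h ▸ List.IsRotated.refl u

theorem map_swap_of_not_mem {X : Type} [DecidableEq X] {a b : X} {w : List X}
    (ha : a ∉ w) (hb : b ∉ w) :
    w.map (Equiv.swap a b) = w := by
  conv_rhs => rw [← List.map_id w]
  refine List.map_congr_left fun x hx => ?_
  exact Equiv.swap_apply_of_ne_of_ne (fun h => ha (h ▸ hx)) (fun h => hb (h ▸ hx))

theorem perm_adjacent_induction {X : Type} {r : List X → List X → Prop} (hrefl : ∀ w, r w w)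
    (htrans : ∀ u v w, r u v → r v w → r u w)
    (hswap : ∀ x a b y, r (x ++ a :: b :: y) (x ++ b :: a :: y))
    {u v : List X} (h : u.Perm v) : r u v := by
  -- The prefix `x` absorbs the common heads met in the `cons` case, so that `hswap` applies at any
  -- depth.
  suffices H : ∀ x, r (x ++ u) (x ++ v) from H []
  induction h with
  | nil => exact fun x => hrefl _
  | cons a _ ih => intro x; simpa using ih (x ++ [a])
  | swap a b l => intro x; exact hswap ..
  | trans _ _ ih ih' => exact fun x => htrans _ _ _ (ih x) (ih' x)

open Classical in
/-- If only tails lie on the last circle then their order does not matter. -/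
theorem semiWelded_setLast (L : GaussDiagram (n + 1))
    (htail : ∀ e ∈ L.word (Fin.last n), e.2 = true) (w : List (L.Arrow × Bool))
    (hw : w.Perm (L.word (Fin.last n))) : L.SemiWelded (L.setLast w hw) := by
  -- `setLast` needs a proof of permutation, so the relation also transports that proof from `u` to
  -- `v`; it is transitive for this reason.
  have key := perm_adjacent_induction (X := L.Arrow × Bool)
    (r := fun u v => ∀ hu : u.Perm (L.word (Fin.last n)), ∃ hv : v.Perm (L.word (Fin.last n)),
      (L.setLast u hu).SemiWelded (L.setLast v hv))
    (fun w hw => ⟨hw, SemiWelded.refl _⟩)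
    (fun u v w h h' hu => (h hu).elim fun hv H => (h' hv).imp fun _ H' => H.trans H') ?_ hw.symm
  · obtain ⟨_, h⟩ := key (List.Perm.refl _)
    have e : L.setLast _ (List.Perm.refl _) = L := by
      simp [setLast, rearrange]
    rwa [e] at h
  · rintro x ⟨a, s⟩ ⟨b, t⟩ y hu
    obtain rfl : s = true := htail (a, s) (hu.subset (by simp))
    obtain rfl : t = true := htail (b, t) (hu.subset (by simp))
    have hv : (x ++ (b, true) :: (a, true) :: y).Perm (L.word (Fin.last n)) :=
      (List.Perm.append_left x (List.Perm.swap ..)).trans hu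
    refine ⟨hv, SemiWelded.of_omegaOCC ⟨a, b, ⟨y ++ x, ?_⟩, Iso.of_isRotated fun i => ?_⟩⟩
    · rw [setLast_word_last]
      exact List.isRotated_append
    · have hnd := hu.nodup_iff.mpr (L.nodup _)
      refine List.IsRotated.symm ?_
      induction i using Fin.lastCases with
      | last =>
        have : (x ++ (a, true) :: (b, true) :: y).map (Equiv.swap (tail a) (tail b)) =
            x ++ (b, true) :: (a, true) :: y := by
          simp only [List.nodup_append, List.nodup_cons, List.mem_cons] at hnd
          rw [List.map_append, List.map_cons, List.map_cons, Equiv.swap_apply_left,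
            Equiv.swap_apply_right, map_swap_of_not_mem, map_swap_of_not_mem]
          all_goals grind
        rw [setLast_word_last, Function.update_self]
        exact isRotated_of_eq this
      | cast i =>
        rw [setLast_word_castSucc, Function.update_of_ne (Fin.castSucc_lt_last i).ne]
        have : (L.word i.castSucc).map (Equiv.swap (tail a) (tail b)) = L.word i.castSucc := by
          apply map_swap_of_not_mem <;> intro h <;>
            exact (Fin.castSucc_lt_last i).ne (L.eq_of_mem_word h (hu.subset (by simp)))
        exact isRotated_of_eq this

end Rearranging

/-! ### Gauss diagrams through occurrence counts. -/

section Counting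

variable {X Y : Type*}

open Classical in
/-- The number of occurrences of a letter. -/
noncomputable def occ (x : X) (l : List X) : ℕ := l.count x

@[simp] theorem occ_nil (x : X) : occ x [] = 0 := rfl

open Classical in
theorem occ_cons (x a : X) (l : List X) : occ x (a :: l) = (if a = x then 1 else 0) + occ x l := by
  simp [occ, List.count_cons, add_comm]

@[simp] theorem occ_append (x : X) (l l' : List X) : occ x (l ++ l') = occ x l + occ x l' := by
  classical exact List.count_append

theorem occ_eq_zero {x : X} {l : List X} (h : x ∉ l) : occ x l = 0 := by
  classical exact List.count_eq_zero_of_not_mem h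

theorem occ_eq_one {x : X} {l : List X} (hl : l.Nodup) (h : x ∈ l) : occ x l = 1 := by
  classical exact List.count_eq_one_of_mem hl h

theorem occ_pos {x : X} {l : List X} : 0 < occ x l ↔ x ∈ l := by
  classical exact List.count_pos_iff

theorem nodup_iff_occ_le_one {l : List X} : l.Nodup ↔ ∀ x, occ x l ≤ 1 := by
  classical exact List.nodup_iff_count_le_one

theorem occ_perm {l l' : List X} (h : l.Perm l') (x : X) : occ x l = occ x l' := by
  classical exact h.count_eq x

theorem occ_map_congr {Z : Type*} {f : Z → X} {g : Z → Y} {x : X} {y : Y} {l : List Z}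
    (h : ∀ z, f z = x ↔ g z = y) : occ x (l.map f) = occ y (l.map g) := by
  induction l with
  | nil => rfl
  | cons a l ih =>
    rw [List.map_cons, List.map_cons, occ_cons, occ_cons, ih]
    congr 1
    by_cases hx : f a = x
    · rw [if_pos hx, if_pos ((h a).mp hx)]
    · rw [if_neg hx, if_neg (mt (h a).mpr hx)]

theorem occ_map_eq {f : X → Y} {x : X} {y : Y} (h : ∀ x', f x' = y ↔ x' = x) (l : List X) :
    occ y (l.map f) = occ x l := by
  conv_rhs => rw [← List.map_id l]
  exact occ_map_congr h

open Classical in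
theorem occ_flatMap_eq {f : X → List Y} {x : X} {y : Y}
    (h : ∀ x', occ y (f x') = if x' = x then 1 else 0) (l : List X) :
    occ y (l.flatMap f) = occ x l := by
  induction l with
  | nil => rfl
  | cons a l ih => rw [List.flatMap_cons, occ_append, occ_cons, ih, h]

/-- This one equation packs the fields `nodup` and `unique` together; `ofOcc` is the converse. It
makes the validity of a new diagram a count that is additive under concatenation. -/
theorem sum_occ_word (D : GaussDiagram n) (e : D.Arrow × Bool) : ∑ i, occ e (D.word i) = 1 := by
  obtain ⟨i, hi, hu⟩ := D.unique e
  rw [Finset.sum_eq_single i]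
  · exact occ_eq_one (D.nodup i) hi
  · exact fun j _ hj => occ_eq_zero fun h => hj (hu j h)
  · simp

/-- The Gauss diagram with given words, if every endpoint occurs exactly once in them. -/
def ofOcc {A : Type} (sign : A → ℤˣ) (w : Fin n → List (A × Bool))
    (h : ∀ e, ∑ i, occ e (w i) = 1) : GaussDiagram n where
  Arrow := A
  sign := sign
  word := w
  nodup i := nodup_iff_occ_le_one.mpr fun e =>
    (h e).symm ▸ Finset.single_le_sum (f := fun i => occ e (w i)) (fun _ _ => Nat.zero_le _)
      (Finset.mem_univ i)
  unique e := by
    obtain ⟨i, -, hi⟩ := Finset.exists_ne_zero_of_sum_ne_zero (h e ▸ one_ne_zero)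
    refine ⟨i, occ_pos.mp (Nat.pos_of_ne_zero hi), fun j hj => ?_⟩
    by_contra hij
    have h1 : occ e (w j) + occ e (w i) ≤ ∑ i, occ e (w i) := by
      rw [← Finset.sum_pair hij (f := fun i => occ e (w i))]
      exact Finset.sum_le_sum_of_subset (Finset.subset_univ _)
    have := occ_pos.mpr hj
    have := h e
    omega

end Counting

/-! ### Marked words -/

/-- A letter of a marked word: an arrow endpoint, or a mark of a given sign, which stands for a
crossing under the last component. -/
abbrev Letter (A : Type) : Type := A × Bool ⊕ ℤˣ

/-- Words in arrow endpoints and marks. -/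
structure Marked (n : ℕ) where
  Arrow : Type
  sign : Arrow → ℤˣ
  word : Fin n → List (Letter Arrow)

/-- Read an arrow endpoint, given the meaning of the arrow. -/
def readLetter {X A : Type} (φ : X → A ⊕ ℤˣ) (e : X × Bool) : Letter A :=
  Sum.map (fun a => (a, e.2)) id (φ e.1)

theorem readLetter_eq_inl {X A : Type} {φ : X → A ⊕ ℤˣ} {e : X × Bool} {a : A × Bool} :
    readLetter φ e = Sum.inl a ↔ φ e.1 = Sum.inl a.1 ∧ e.2 = a.2 := by
  unfold readLetter
  rcases φ e.1 with x | s
  · simp [Prod.ext_iff]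
  · simp

theorem readLetter_eq_inr {X A : Type} {φ : X → A ⊕ ℤˣ} {e : X × Bool} {s : ℤˣ} :
    readLetter φ e = Sum.inr s ↔ φ e.1 = Sum.inr s := by
  unfold readLetter
  rcases φ e.1 with x | s <;> simp

theorem isRight_readLetter {X A : Type} {φ : X → A ⊕ ℤˣ} {e : X × Bool} :
    (readLetter φ e).isRight = (φ e.1).isRight := by
  unfold readLetter
  rcases φ e.1 with x | s <;> simp

/-- `L` realizes the marked words `M`: the tails of the marks form the last component. -/
structure Realizes (L : GaussDiagram (n + 1)) (M : Marked n) (φ : L.Arrow → M.Arrow ⊕ ℤˣ) :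
    Prop where
  bij : ∀ a, ∃! x, φ x = Sum.inl a
  sign : ∀ x, L.sign x = Sum.elim M.sign id (φ x)
  last : ∀ e, e ∈ L.word (Fin.last n) ↔ e.2 = true ∧ (φ e.1).isRight = true
  word : ∀ i : Fin n, (L.word i.castSucc).map (readLetter φ) ~r M.word i

namespace Marked

/-- Every endpoint occurs exactly once. -/
def WF (M : Marked n) : Prop := ∀ e, ∑ i, occ (Sum.inl e) (M.word i) = 1

/-- The positions of the marks. -/
abbrev Mark (M : Marked n) : Type :=
  {p : Σ i, Fin (M.word i).length // ((M.word p.1).get p.2).isRight = true}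

/-- The endpoint at a given position in the standard realization. -/
def stdEndpoint (M : Marked n) (i : Fin n) (j : Fin (M.word i).length) :
    (M.Arrow ⊕ M.Mark) × Bool :=
  if h : ((M.word i).get j).isRight = true then (Sum.inr ⟨⟨i, j⟩, h⟩, false)
  else (Sum.inl (((M.word i).get j).getLeft (by simpa using h)).1,
    (((M.word i).get j).getLeft (by simpa using h)).2)

/-- The sign of an arrow in the standard realization. -/
def stdSign (M : Marked n) : M.Arrow ⊕ M.Mark → ℤˣ :=
  Sum.elim M.sign fun p => ((M.word p.1.1).get p.1.2).getRight p.2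

/-- The words of the standard realization. -/
noncomputable def stdWord (M : Marked n) : Fin (n + 1) → List ((M.Arrow ⊕ M.Mark) × Bool) :=
  Fin.snoc (α := fun _ => List ((M.Arrow ⊕ M.Mark) × Bool))
    (fun i => (List.finRange (M.word i).length).map (M.stdEndpoint i))
    ((Finset.univ : Finset M.Mark).toList.map fun p => tail (Sum.inr p))

theorem stdEndpoint_eq_inl {M : Marked n} {i : Fin n} {j : Fin (M.word i).length} {a : M.Arrow}
    {b : Bool} : M.stdEndpoint i j = (Sum.inl a, b) ↔ (M.word i).get j = Sum.inl (a, b) := by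
  unfold stdEndpoint
  split_ifs with h
  · refine iff_of_false (by simp) fun h' => ?_
    rw [h'] at h
    simp at h
  · have key : ∀ (x : Letter M.Arrow) (hx : x.isLeft = true),
        ((Sum.inl (x.getLeft hx).1, (x.getLeft hx).2) : (M.Arrow ⊕ M.Mark) × Bool) =
          (Sum.inl a, b) ↔ x = Sum.inl (a, b) := by
      rintro (x | x) hx
      · simp [Prod.ext_iff]
      · simp at hx
    exact key _ _

theorem stdEndpoint_eq_inr {M : Marked n} {i : Fin n} {j : Fin (M.word i).length} {p : M.Mark}
    {b : Bool} : M.stdEndpoint i j = (Sum.inr p, b) ↔ b = false ∧ ⟨i, j⟩ = p.1 := by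
  unfold stdEndpoint
  split_ifs with h
  · simp only [Prod.mk.injEq, Sum.inr.injEq, Subtype.ext_iff]
    tauto
  · simp only [Prod.mk.injEq, reduceCtorEq, false_and, false_iff, not_and]
    rintro - h'
    have := p.2
    rw [← h'] at this
    exact h this

theorem sum_occ_stdWord {M : Marked n} (hM : M.WF) (e : (M.Arrow ⊕ M.Mark) × Bool) :
    ∑ i, occ e (M.stdWord i) = 1 := by
  simp only [Fin.sum_univ_castSucc, stdWord, Fin.snoc_castSucc, Fin.snoc_last]
  obtain ⟨a | p, b⟩ := e
  · rw [← hM (a, b), occ_eq_zero (by simp), add_zero]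
    refine Finset.sum_congr rfl fun i _ => ?_
    conv_rhs => rw [← List.map_get_finRange (M.word i)]
    exact occ_map_congr fun j => stdEndpoint_eq_inl
  · cases b
    · rw [occ_eq_zero (by simp), add_zero, Finset.sum_eq_single p.1.1]
      · rw [occ_map_eq (x := p.1.2)]
        · exact occ_eq_one (List.nodup_finRange _) (List.mem_finRange _)
        · intro j
          rw [stdEndpoint_eq_inr]
          constructor
          · rintro ⟨-, h⟩
            rw [Sigma.ext_iff] at h
            exact eq_of_heq h.2
          · rintro rfl
            exact ⟨rfl, rfl⟩
      · intro i _ hi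
        refine occ_eq_zero fun h => ?_
        obtain ⟨j, -, h⟩ := List.mem_map.mp h
        rw [stdEndpoint_eq_inr] at h
        exact hi (congrArg Sigma.fst h.2)
      · simp
    · rw [Finset.sum_eq_zero, zero_add, occ_map_eq (x := p)]
      · exact occ_eq_one (Finset.nodup_toList _) (by simp)
      · simp
      · intro i _
        refine occ_eq_zero fun h => ?_
        obtain ⟨j, -, h⟩ := List.mem_map.mp h
        rw [stdEndpoint_eq_inr] at h
        simp at h

/-- The standard realization. -/
noncomputable def std (M : Marked n) (hM : M.WF) : GaussDiagram (n + 1) :=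
  ofOcc M.stdSign M.stdWord (sum_occ_stdWord hM)

/-- The meaning of the arrows in the standard realization. -/
def stdMeaning (M : Marked n) : M.Arrow ⊕ M.Mark → M.Arrow ⊕ ℤˣ :=
  Sum.map id fun p => ((M.word p.1.1).get p.1.2).getRight p.2

theorem readLetter_stdEndpoint (M : Marked n) (i : Fin n) (j : Fin (M.word i).length) :
    readLetter M.stdMeaning (M.stdEndpoint i j) = (M.word i).get j := by
  rcases h : M.stdEndpoint i j with ⟨a | p, b⟩
  · rw [stdEndpoint_eq_inl] at h
    rw [h, readLetter_eq_inl]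
    simp [stdMeaning]
  · rw [stdEndpoint_eq_inr] at h
    obtain ⟨rfl, h⟩ := h
    obtain ⟨p, hp⟩ := p
    subst h
    simp [readLetter, stdMeaning]

theorem std_realizes (M : Marked n) (hM : M.WF) :
    Realizes (M.std hM) M (M.stdMeaning : M.Arrow ⊕ M.Mark → M.Arrow ⊕ ℤˣ) where
  bij a := by
    refine ⟨(Sum.inl a : M.Arrow ⊕ M.Mark), rfl, fun (x : M.Arrow ⊕ M.Mark) hx => ?_⟩
    rcases x with x | x
    · exact congrArg Sum.inl (Sum.inl_injective hx)
    · cases hx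
  sign := fun (x : M.Arrow ⊕ M.Mark) => by rcases x with x | x <;> rfl
  last := fun (e : (M.Arrow ⊕ M.Mark) × Bool) => by
    change e ∈ M.stdWord (Fin.last n) ↔ _
    rw [stdWord, Fin.snoc_last, List.mem_map]
    obtain ⟨x | x, b⟩ := e
    · simp [stdMeaning]
    · constructor
      · rintro ⟨p, -, hp⟩
        exact ⟨(congrArg Prod.snd hp).symm, rfl⟩
      · rintro ⟨h, -⟩
        exact ⟨x, by simp, Prod.ext rfl h.symm⟩
  word i := by
    change (M.stdWord i.castSucc).map _ ~r _
    rw [stdWord, Fin.snoc_castSucc]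
    refine isRotated_of_eq ?_
    conv_rhs => rw [← List.map_get_finRange (M.word i)]
    exact (List.map_map ..).trans (List.map_congr_left fun j _ => M.readLetter_stdEndpoint i j)

end Marked

namespace Realizes

variable {L : GaussDiagram (n + 1)} {M : Marked n} {φ : L.Arrow → M.Arrow ⊕ ℤˣ}

/-- The arrow of the realization that corresponds to an arrow of the marked words. -/
noncomputable def lift (h : Realizes L M φ) (a : M.Arrow) : L.Arrow := (h.bij a).choose

theorem map_lift (h : Realizes L M φ) (a : M.Arrow) : φ (h.lift a) = Sum.inl a :=
  (h.bij a).choose_spec.1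

theorem eq_lift_iff (h : Realizes L M φ) {a : M.Arrow} {x : L.Arrow} :
    x = h.lift a ↔ φ x = Sum.inl a :=
  ⟨fun hx => hx ▸ h.map_lift a, fun hx => (h.bij a).unique hx (h.map_lift a)⟩

theorem lift_injective (h : Realizes L M φ) : Function.Injective h.lift := fun a b hab => by
  have := h.map_lift a
  rw [hab, h.map_lift] at this
  exact (Sum.inl_injective this).symm

/-- The endpoint of the realization that corresponds to an endpoint of the marked words. -/
noncomputable def liftEnd (h : Realizes L M φ) (e : M.Arrow × Bool) : L.Arrow × Bool :=
  (h.lift e.1, e.2)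

theorem readLetter_eq_inl_iff (h : Realizes L M φ) {x : L.Arrow × Bool} {e : M.Arrow × Bool} :
    readLetter φ x = Sum.inl e ↔ x = h.liftEnd e := by
  rw [readLetter_eq_inl, liftEnd, Prod.ext_iff, h.eq_lift_iff]

/-- Endpoints of unmarked arrows avoid the last circle, so their count in `L` is the count in `M`.
Together with `std_realizes`, well-formed marked words are exactly the realizable ones. -/
theorem wf (h : Realizes L M φ) : M.WF := fun e => by
  have h0 : occ (h.liftEnd e) (L.word (Fin.last n)) = 0 := occ_eq_zero fun hm => by
    have := ((h.last _).mp hm).2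
    rw [liftEnd, h.map_lift] at this
    simp at this
  rw [← sum_occ_word L (h.liftEnd e), Fin.sum_univ_castSucc, h0, add_zero]
  refine Finset.sum_congr rfl fun i _ => ?_
  rw [← occ_perm (h.word i).perm, occ_map_eq fun x => h.readLetter_eq_inl_iff]

/-- The tail of a mark is on the last circle, and an endpoint lies on only one circle. -/
theorem head_of_mark (h : Realizes L M φ) {e : L.Arrow × Bool} {i : Fin n}
    (he : e ∈ L.word i.castSucc) (hm : (φ e.1).isRight = true) : e.2 = false := by
  by_contra hb
  exact (Fin.castSucc_lt_last i).ne (L.eq_of_mem_word he ((h.last e).mpr ⟨by simpa using hb, hm⟩))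

theorem setLast (h : Realizes L M φ) (w : List (L.Arrow × Bool))
    (hw : w.Perm (L.word (Fin.last n))) : Realizes (L.setLast w hw) M φ where
  bij := h.bij
  sign := h.sign
  last e := by rw [setLast_word_last]; exact hw.mem_iff.trans (h.last e)
  word i := by rw [setLast_word_castSucc]; exact h.word i

theorem exists_lifted_word (h : Realizes L M φ) {i : Fin n} {w : List (Letter M.Arrow)}
    (hw : M.word i ~r w) : ∃ u, L.word i.castSucc ~r u ∧ u.map (readLetter φ) = w := by
  obtain ⟨k, hk⟩ := (h.word i).trans hw
  exact ⟨(L.word i.castSucc).rotate k, ⟨k, rfl⟩, by rw [List.map_rotate, hk]⟩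

theorem next_lift (h : Realizes L M φ) {i : Fin n} {e f : M.Arrow × Bool}
    {l : List (Letter M.Arrow)} (hw : M.word i ~r Sum.inl e :: Sum.inl f :: l) :
    L.Next i.castSucc (h.liftEnd e) (h.liftEnd f) := by
  obtain ⟨u, hu, hmap⟩ := h.exists_lifted_word hw
  obtain ⟨x, u, rfl, hx, hmap⟩ := List.map_eq_cons_iff.mp hmap
  obtain ⟨y, u, rfl, hy, -⟩ := List.map_eq_cons_iff.mp hmap
  rw [h.readLetter_eq_inl_iff] at hx hy
  exact ⟨u, hx ▸ hy ▸ hu⟩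

end Realizes

/-- Isomorphic diagrams except for the order of the tails on the last component. -/
theorem semiWelded_of_equiv {L L' : GaussDiagram (n + 1)} (f : L.Arrow ≃ L'.Arrow)
    (hsign : ∀ a, L'.sign (f a) = L.sign a)
    (hword : ∀ i : Fin n, (L.word i.castSucc).map (Prod.map f id) ~r L'.word i.castSucc)
    (hlast : ((L.word (Fin.last n)).map (Prod.map f id)).Perm (L'.word (Fin.last n)))
    (htail : ∀ e ∈ L'.word (Fin.last n), e.2 = true) : L.SemiWelded L' := by
  refine SemiWelded.trans (L' := L'.setLast _ hlast) (SemiWelded.of_move (Move.iso ?_))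
    (SemiWelded.symm (semiWelded_setLast L' htail _ hlast))
  refine ⟨f, hsign, fun i => ?_⟩
  induction i using Fin.lastCases with
  | last => rw [setLast_word_last]; exact List.IsRotated.refl _
  | cast i => rw [setLast_word_castSucc]; exact hword i

namespace Realizes

variable {L : GaussDiagram (n + 1)} {M : Marked n} {φ : L.Arrow → M.Arrow ⊕ ℤˣ}

/-- The marked words determine everything except the order of the tails on the last circle: matching
positions in the words yields a bijection of arrows that preserves signs and the first n words. Then
`semiWelded_of_equiv` applies. -/
theorem semiWelded_std (h : Realizes L M φ) (hM : M.WF) : (M.std hM).SemiWelded L := by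
  choose u hu hmap using fun i => h.exists_lifted_word (List.IsRotated.refl (M.word i))
  have hlen : ∀ i, (M.word i).length = (u i).length := fun i => by rw [← hmap i, List.length_map]
  have hget : ∀ i (j : Fin (M.word i).length),
      readLetter φ ((u i).get (j.cast (hlen i))) = (M.word i).get j := fun i j => by
    have := List.getElem_of_eq (hmap i) (i := j) (by simpa using (j.cast (hlen i)).isLt)
    simpa using this
  have hmem : ∀ {i e}, e ∈ u i ↔ e ∈ L.word i.castSucc := fun {i e} => (hu i).mem_iff.symm
  -- A mark goes to the arrow whose head stands at the same position in `u`, the rotation of the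
  -- word of `L` that reads exactly as `M.word`.
  let g : M.Arrow ⊕ M.Mark → L.Arrow :=
    Sum.elim h.lift fun p => ((u p.1.1).get (p.1.2.cast (hlen _))).1
  have hg : ∀ i (j : Fin (M.word i).length),
      Prod.map g id (M.stdEndpoint i j) = (u i).get (j.cast (hlen i)) := by
    intro i j
    rcases hs : M.stdEndpoint i j with ⟨a | p, b⟩
    · rw [Marked.stdEndpoint_eq_inl, ← hget, h.readLetter_eq_inl_iff] at hs
      rw [hs]; rfl
    · rw [Marked.stdEndpoint_eq_inr] at hs
      obtain ⟨rfl, hs⟩ := hs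
      obtain ⟨p, hp⟩ := p
      subst hs
      refine Prod.ext rfl ?_
      refine (h.head_of_mark (hmem.mp (List.get_mem ..)) ?_).symm
      rw [← isRight_readLetter, hget]
      exact hp
  have hφ : ∀ x, φ (g x) = M.stdMeaning x := by
    rintro (a | ⟨⟨i, j⟩, hp⟩)
    · exact h.map_lift a
    · have := hget i j
      change φ ((u i).get (j.cast (hlen i))).1 = Sum.inr (((M.word i).get j).getRight hp)
      rw [← readLetter_eq_inr, this, Sum.inr_getRight]
  have hinj : Function.Injective g := by
    rintro (a | p) (b | q) hxy
    · exact congrArg _ (h.lift_injective hxy)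
    · have h1 := hφ (Sum.inl a)
      rw [hxy, hφ] at h1
      cases h1
    · have h1 := hφ (Sum.inr p)
      rw [hxy, hφ] at h1
      cases h1
    · obtain ⟨⟨i, j⟩, hp⟩ := p
      obtain ⟨⟨i', j'⟩, hq⟩ := q
      have e1 : (u i).get (j.cast (hlen i)) = (u i').get (j'.cast (hlen i')) := by
        rw [← hg, ← hg, (Marked.stdEndpoint_eq_inr (p := ⟨⟨i, j⟩, hp⟩)).mpr ⟨rfl, rfl⟩,
          (Marked.stdEndpoint_eq_inr (p := ⟨⟨i', j'⟩, hq⟩)).mpr ⟨rfl, rfl⟩]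
        exact Prod.ext hxy rfl
      obtain rfl : i = i' := Fin.castSucc_injective n
        (L.eq_of_mem_word (e := (u i).get (j.cast (hlen i))) (hmem.mp (List.get_mem ..))
          (by rw [e1]; exact hmem.mp (List.get_mem ..)))
      have := (List.nodup_iff_injective_get.mp ((hu i).nodup_iff.mp (L.nodup _))) e1
      simp only [Fin.cast_inj] at this
      subst this
      rfl
  have hsurj : Function.Surjective g := by
    intro x
    rcases hx : φ x with a | s
    · exact ⟨Sum.inl a, (h.eq_lift_iff.mpr hx).symm⟩
    · obtain ⟨i, hi, -⟩ := L.unique (head x)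
      induction i using Fin.lastCases with
      | last => simpa using ((h.last _).mp hi).1
      | cast i =>
        obtain ⟨j, hj⟩ := List.mem_iff_get.mp (hmem.mpr hi)
        have h1 := hget i (j.cast (hlen i).symm)
        refine ⟨Sum.inr ⟨⟨i, j.cast (hlen i).symm⟩, ?_⟩, ?_⟩
        · rw [← h1, isRight_readLetter]
          simp only [Fin.cast_cast, Fin.cast_eq_self, hj, hx, Sum.isRight_inr]
        · change ((u i).get ((j.cast (hlen i).symm).cast (hlen i))).1 = x
          simp only [Fin.cast_cast, Fin.cast_eq_self, hj]
  refine semiWelded_of_equiv (L := M.std hM) (Equiv.ofBijective g ⟨hinj, hsurj⟩) ?_ ?_ ?_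
    fun e he => ((h.last e).mp he).1
  · intro x
    have h1 : L.sign (g x) = Sum.elim M.sign id (M.stdMeaning x) :=
      (h.sign (g x)).trans (congrArg _ (hφ x))
    exact h1.trans ((M.std_realizes hM).sign x).symm
  · intro i
    refine List.IsRotated.trans (isRotated_of_eq ?_) (hu i).symm
    change (M.stdWord i.castSucc).map (Prod.map g id) = u i
    rw [Marked.stdWord, Fin.snoc_castSucc, List.map_map]
    refine List.ext_get (by simp [hlen]) fun j h1 h2 => ?_
    simpa using hg i ⟨j, by simpa using h1⟩
  · have hmeas := (M.std_realizes hM).last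
    refine (List.perm_ext_iff_of_nodup ?_ (L.nodup _)).mpr fun x => ?_
    · exact ((M.std hM).nodup _).map (hinj.prodMap Function.injective_id)
    · rw [List.mem_map, h.last]
      constructor
      · rintro ⟨e, he, rfl⟩
        have := (hmeas e).mp he
        exact ⟨this.1, by rw [← this.2]; exact congrArg Sum.isRight (hφ e.1)⟩
      · rintro ⟨h1, h2⟩
        obtain ⟨y, hy⟩ := hsurj x.1
        refine ⟨(y, true), (hmeas _).mpr ⟨rfl, ?_⟩, Prod.ext hy h1.symm⟩
        rw [← hφ, hy, h2]

theorem semiWelded {L' : GaussDiagram (n + 1)} {φ' : L'.Arrow → M.Arrow ⊕ ℤˣ}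
    (h : Realizes L M φ) (h' : Realizes L' M φ') : L.SemiWelded L' :=
  (h.semiWelded_std h.wf).symm.trans (h'.semiWelded_std h.wf)

end Realizes

/-! ### Semi-welded equivalence of marked words. -/

namespace Marked

/-- Marked words whose realizations are semi-welded equivalent. -/
def Sw (M M' : Marked n) : Prop :=
  (M.WF ↔ M'.WF) ∧ ∀ L φ L' φ', Realizes L M φ → Realizes L' M' φ' → L.SemiWelded L'

theorem Sw.refl (M : Marked n) : M.Sw M := ⟨Iff.rfl, fun _ _ _ _ h h' => h.semiWelded h'⟩

theorem Sw.symm {M M' : Marked n} (h : M.Sw M') : M'.Sw M :=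
  ⟨h.1.symm, fun _ _ _ _ hL hL' => (h.2 _ _ _ _ hL' hL).symm⟩

/-- Transitivity needs some realization of the middle words. This is why `Sw` includes the
equivalence of well-formedness: it makes the standard realization of `M'` available. -/
theorem Sw.trans {M M' M'' : Marked n} (h : M.Sw M') (h' : M'.Sw M'') : M.Sw M'' :=
  ⟨h.1.trans h'.1, fun _ _ _ _ hL hL' =>
    have hs := M'.std_realizes (h.1.mp hL.wf)
    (h.2 _ _ _ _ hL hs).trans (h'.2 _ _ _ _ hs hL')⟩

/-- One pair of equivalent realizations suffices, since realizations of the same marked words are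
equivalent to each other. -/
theorem Sw.of_realizes {M M' : Marked n} {L L' : GaussDiagram (n + 1)}
    {φ : L.Arrow → M.Arrow ⊕ ℤˣ} {φ' : L'.Arrow → M'.Arrow ⊕ ℤˣ} (h : Realizes L M φ)
    (h' : Realizes L' M' φ') (hL : L.SemiWelded L') : M.Sw M' :=
  ⟨iff_of_true h.wf h'.wf, fun _ _ _ _ hX hX' =>
    (hX.semiWelded h).trans (hL.trans (h'.semiWelded hX'))⟩

theorem Sw.of_wf {M M' : Marked n} (h : M.WF ↔ M'.WF) (hs : M.WF → M.Sw M') : M.Sw M' := by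
  by_cases hM : M.WF
  · exact hs hM
  · exact ⟨h, fun _ _ _ _ hL _ => absurd hL.wf hM⟩

theorem Sw.of_isRotated {A : Type} {s : A → ℤˣ} {w w' : Fin n → List (Letter A)}
    (h : ∀ i, w i ~r w' i) : Sw ⟨A, s, w⟩ ⟨A, s, w'⟩ := by
  refine Sw.of_wf (forall_congr' fun e => ?_) fun hM => ?_
  · simp only [fun i => occ_perm (h i).perm]
  · have h1 := std_realizes _ hM
    exact Sw.of_realizes h1
      (⟨h1.bij, h1.sign, h1.last, fun i => (h1.word i).trans (h i)⟩ : Realizes _ ⟨A, s, w'⟩ _)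
      (SemiWelded.refl _)

end Marked

/-! ### Cyclic rotation and deletion of letters. -/

section Rotation

variable {X Y : Type*}

theorem exists_append_of_isRotated {u v : List X} (h : u ~r v) :
    ∃ x y, u = x ++ y ∧ v = y ++ x := by
  obtain ⟨k, rfl⟩ := h
  exact ⟨u.take (k % u.length), u.drop (k % u.length), (List.take_append_drop ..).symm,
    List.rotate_eq_drop_append_take_mod⟩

theorem isRotated_flatMap {u v : List X} (h : u ~r v) (f : X → List Y) :
    u.flatMap f ~r v.flatMap f := by
  obtain ⟨x, y, rfl, rfl⟩ := exists_append_of_isRotated h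
  rw [List.flatMap_append, List.flatMap_append]
  exact List.isRotated_append

theorem isRotated_filterMap {u v : List X} (h : u ~r v) (f : X → Option Y) :
    u.filterMap f ~r v.filterMap f := by
  obtain ⟨x, y, rfl, rfl⟩ := exists_append_of_isRotated h
  rw [List.filterMap_append, List.filterMap_append]
  exact List.isRotated_append

theorem map_keep_of_forall {A : Type} {Z : Type*} {p : A → Prop} {w : List (A × Bool)}
    (hw : ∀ e ∈ w, p e.1) {f : A × Bool → Z} {g : {a // p a} × Bool → Z}
    (hg : ∀ e, g e = f (e.1.1, e.2)) : (keep p w).map g = w.map f := by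
  induction w with
  | nil => rfl
  | cons e w ih =>
    have he : p e.1 := hw e (by simp)
    have h1 : keep p (e :: w) = (⟨e.1, he⟩, e.2) :: keep p w := by simp [keep, he]
    rw [h1, List.map_cons, List.map_cons, ih fun e' h => hw e' (List.mem_cons_of_mem _ h), hg]

theorem keep_append {A : Type} (p : A → Prop) (w w' : List (A × Bool)) :
    keep p (w ++ w') = keep p w ++ keep p w' :=
  List.filterMap_append

theorem keep_cons_of_not {A : Type} {p : A → Prop} {e : A × Bool} (he : ¬p e.1)
    (w : List (A × Bool)) : keep p (e :: w) = keep p w := by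
  simp [keep, he]

end Rotation

theorem Realizes.restrict {L : GaussDiagram (n + 1)} {M M' : Marked n}
    {φ : L.Arrow → M.Arrow ⊕ ℤˣ} (h : Realizes L M φ) (p : L.Arrow → Prop)
    (ψ : {x // p x} → M'.Arrow ⊕ ℤˣ) (hbij : ∀ a, ∃! x, ψ x = Sum.inl a)
    (hsign : ∀ x, L.sign x.1 = Sum.elim M'.sign id (ψ x))
    (hright : ∀ x, (ψ x).isRight = (φ x.1).isRight)
    (hword : ∀ i : Fin n, ∃ u, L.word i.castSucc ~r u ∧
      (keep p u).map (readLetter ψ) ~r M'.word i) : Realizes (L.restrict p) M' ψ where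
  bij := hbij
  sign := hsign
  last := fun (e : {x // p x} × Bool) => by
    rw [hright, ← h.last (e.1.1, e.2)]
    exact mem_keep
  word i := by
    obtain ⟨u, hu, hm⟩ := hword i
    exact ((isRotated_filterMap hu _).map _).trans hm

namespace Marked

/-- With both pairs of neighbours in place this is a single second Reidemeister move; the arrows
that are removed are marks, so every arrow of `A` survives. -/
theorem _root_.GaussDiagram.Realizes.sw_cancel {A : Type} {s : A → ℤˣ}
    {w w' : Fin n → List (Letter A)} {L : GaussDiagram (n + 1)} {φ : L.Arrow → A ⊕ ℤˣ}
    (h : Realizes L ⟨A, s, w⟩ φ) {a b : L.Arrow} {i : Fin n} {l u v : List (L.Arrow × Bool)}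
    {t : ℤˣ} (hlast : L.word (Fin.last n) = tail a :: tail b :: l)
    (hi : L.word i.castSucc ~r u ++ head a :: head b :: v) (ha : φ a = Sum.inr t)
    (hb : φ b = Sum.inr (-t))
    (hself : (u ++ v).map (readLetter φ) ~r w' i)
    (hne : ∀ j ≠ i, (L.word j.castSucc).map (readLetter φ) ~r w' j) : Sw ⟨A, s, w⟩ ⟨A, s, w'⟩ := by
  have hmem : ∀ {j : Fin n} {e}, e ∈ L.word j.castSucc → (j ≠ i ∨ e ∈ u ++ v) →
      e.1 ≠ a ∧ e.1 ≠ b := by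
    have key : ∀ c, (c = a ∨ c = b) → ∀ {j : Fin n} {e}, e ∈ L.word j.castSucc →
        (j ≠ i ∨ e ∈ u ++ v) → e.1 ≠ c := by
      rintro c hc j ⟨z, β⟩ he hj (rfl : z = c)
      obtain rfl : β = false := h.head_of_mark he (by rcases hc with rfl | rfl <;> simp [ha, hb])
      have hm := hi.mem_iff.mpr (show (z, false) ∈ u ++ head a :: head b :: v by
        rcases hc with rfl | rfl <;> simp)
      obtain rfl := Fin.castSucc_injective n (L.eq_of_mem_word he hm)
      have hnd := hi.nodup_iff.mp (L.nodup _)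
      rcases hj with hj | hj
      · exact hj rfl
      · simp only [List.nodup_append, List.nodup_cons, List.mem_cons, List.mem_append] at hnd hj
        rcases hc with rfl | rfl <;> grind
    exact fun {_ _} he hj => ⟨key a (Or.inl rfl) he hj, key b (Or.inr rfl) he hj⟩
  have hres : Realizes (L.restrict fun x => x ≠ a ∧ x ≠ b) ⟨A, s, w'⟩ fun x => φ x.1 := by
    refine h.restrict _ _ (fun c => ?_) (fun x => h.sign x.1) (fun _ => rfl) fun j => ?_
    · refine ⟨⟨h.lift c, ?_, ?_⟩, h.map_lift c, fun x hx => Subtype.ext (h.eq_lift_iff.mpr hx)⟩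
      · intro hc
        have := h.map_lift c
        rw [hc, ha] at this
        cases this
      · intro hc
        have := h.map_lift c
        rw [hc, hb] at this
        cases this
    · by_cases hj : j = i
      · subst hj
        refine ⟨_, hi, ?_⟩
        rw [keep_append, keep_cons_of_not (by simp), keep_cons_of_not (by simp), ← keep_append,
          map_keep_of_forall (f := readLetter φ)]
        · exact hself
        · intro e he
          exact hmem (hi.mem_iff.mpr (by simp at he ⊢; tauto)) (Or.inr he)
        · exact fun e => rfl
      · refine ⟨_, List.IsRotated.refl _, ?_⟩
        rw [map_keep_of_forall (f := readLetter φ)]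
        · exact hne j hj
        · exact fun e he => hmem he (Or.inl hj)
        · exact fun e => rfl
  refine Sw.of_realizes h hres (SemiWelded.of_move (Move.omega2 ⟨a, b, Fin.last n, i.castSucc, ?_,
    ⟨l, isRotated_of_eq hlast⟩, Or.inl ⟨v ++ u, hi.trans List.isRotated_append⟩, Iso.refl _⟩))
  rw [h.sign, h.sign, ha, hb]
  simp

theorem exists_realizes {M : Marked n} (hM : M.WF) :
    ∃ L, ∃ φ : L.Arrow → M.Arrow ⊕ ℤˣ, Realizes L M φ :=
  ⟨_, _, M.std_realizes hM⟩

/-- Two neighbouring marks of opposite signs cancel. -/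
theorem sw_cancel {A : Type} (s : A → ℤˣ) (w : Fin n → List (Letter A)) (i : Fin n)
    (x y : List (Letter A)) (t : ℤˣ) :
    Sw ⟨A, s, Function.update w i (x ++ Sum.inr t :: Sum.inr (-t) :: y)⟩
      ⟨A, s, Function.update w i (x ++ y)⟩ := by
  refine Sw.of_wf (forall_congr' fun e => ?_) fun hM => ?_
  · refine Eq.congr (Finset.sum_congr rfl fun j _ => ?_) rfl
    by_cases hj : j = i
    · subst hj; simp [occ_cons]
    · simp [Function.update_of_ne hj]
  obtain ⟨L, φ, h⟩ := exists_realizes hM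
  obtain ⟨u, hu, hmap⟩ := h.exists_lifted_word (i := i) (List.IsRotated.refl _)
  dsimp only at hmap
  rw [Function.update_self] at hmap
  obtain ⟨ux, u, rfl, hx, hmap⟩ := List.map_eq_append_iff.mp hmap
  obtain ⟨⟨a, sa⟩, u, rfl, ha, hmap⟩ := List.map_eq_cons_iff.mp hmap
  obtain ⟨⟨b, sb⟩, uy, rfl, hb, hy⟩ := List.map_eq_cons_iff.mp hmap
  rw [readLetter_eq_inr] at ha hb
  dsimp only at ha hb
  have hnd := hu.nodup_iff.mp (L.nodup _)
  have hma := hu.mem_iff.mpr (show (a, sa) ∈ _ by simp)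
  have hmb := hu.mem_iff.mpr (show (b, sb) ∈ _ by simp)
  obtain rfl : sa = false := h.head_of_mark hma (by rw [ha]; rfl)
  obtain rfl : sb = false := h.head_of_mark hmb (by rw [hb]; rfl)
  have hab : a ≠ b := by
    rintro rfl
    simp [List.nodup_append] at hnd
  -- The second move also needs neighbouring tails; since order on the last circle is free, both
  -- tails are brought to its front.
  have hlast : ∃ l, (tail a :: tail b :: l).Perm (L.word (Fin.last n)) := by
    obtain ⟨l, hl⟩ := List.append_of_mem ((h.last (tail a)).mpr ⟨rfl, by rw [ha]; rfl⟩)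
    have hb' : tail b ∈ L.word (Fin.last n) := (h.last (tail b)).mpr ⟨rfl, by rw [hb]; rfl⟩
    obtain ⟨l', hl⟩ := hl
    have hb'' : tail b ∈ l ++ l' := by
      rw [hl] at hb'
      simp only [List.mem_append, List.mem_cons, Prod.mk.injEq, and_true, hab.symm,
        false_or] at hb' ⊢
      exact hb'
    obtain ⟨m, m', hm⟩ := List.append_of_mem hb''
    refine ⟨m ++ m', ?_⟩
    rw [hl]
    refine List.Perm.trans (List.Perm.cons _ ?_) List.perm_middle.symm
    rw [hm]
    exact List.perm_middle.symm
  obtain ⟨l, hl⟩ := hlast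
  have h2 := h.setLast _ hl
  refine h2.sw_cancel (a := a) (b := b) (i := i) (u := ux) (v := uy) (t := t)
    (setLast_word_last ..) ?_ ha hb
    ?_ fun j hj => ?_
  · rw [setLast_word_castSucc]; exact hu
  · rw [Function.update_self]
    exact isRotated_of_eq ((List.map_append ..).trans (congrArg₂ _ hx hy))
  · have := h2.word j
    dsimp only at this
    rwa [Function.update_of_ne hj] at this ⊢

end Marked

/-! ### Marked words up to cancellation of marks -/

section Reduction

/-- Two neighbouring marks of opposite signs. -/
inductive CancelRel (A : Type) : FreeMonoid (Letter A) → FreeMonoid (Letter A) → Prop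
  | intro (t : ℤˣ) : CancelRel A (FreeMonoid.ofList [Sum.inr t, Sum.inr (-t)]) 1

/-- The monoid of marked words up to cancellation of marks. -/
abbrev Reduced (A : Type) : Type := (conGen (CancelRel A)).Quotient

variable {A : Type}

/-- The class of a marked word. -/
def red (w : List (Letter A)) : Reduced A := ((FreeMonoid.ofList w : FreeMonoid (Letter A)) : _)

@[simp] theorem red_nil : red ([] : List (Letter A)) = 1 := rfl

@[simp] theorem red_append (u v : List (Letter A)) : red (u ++ v) = red u * red v := rfl

theorem red_cons (x : Letter A) (u : List (Letter A)) : red (x :: u) = red [x] * red u := rfl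

theorem red_mark_mul_red_mark_neg (t : ℤˣ) :
    red ([Sum.inr t] : List (Letter A)) * red [Sum.inr (-t)] = 1 :=
  (Con.eq _).mpr (ConGen.Rel.of _ _ (CancelRel.intro t))

/-- The class of a positive mark. -/
def markUnit (A : Type) : (Reduced A)ˣ where
  val := red [Sum.inr 1]
  inv := red [Sum.inr (-1)]
  val_inv := red_mark_mul_red_mark_neg 1
  inv_val := by simpa using red_mark_mul_red_mark_neg (A := A) (-1)

/-- The powers of the class of a positive mark. -/
def markPow (A : Type) (k : ℤ) : Reduced A := (markUnit A ^ k : (Reduced A)ˣ)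

@[simp] theorem markPow_zero : markPow A 0 = 1 := by simp [markPow]

theorem markPow_add (k l : ℤ) : markPow A (k + l) = markPow A k * markPow A l := by
  simp [markPow, zpow_add]

@[simp] theorem markPow_mul (k l : ℤ) : markPow A k * markPow A l = markPow A (k + l) :=
  (markPow_add k l).symm

@[simp] theorem markPow_mul_assoc (k l : ℤ) (x : Reduced A) :
    markPow A k * (markPow A l * x) = markPow A (k + l) * x := by
  rw [← mul_assoc, markPow_mul]

@[simp] theorem red_mark (t : ℤˣ) : red ([Sum.inr t] : List (Letter A)) = markPow A t := by
  rcases Int.units_eq_one_or t with rfl | rfl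
  · simp [markPow, markUnit]
  · simp [markPow, markUnit]

/-- The word of `|k|` marks of the sign of `k`. -/
def run (A : Type) (k : ℤ) : List (Letter A) :=
  List.replicate k.natAbs (Sum.inr (if 0 ≤ k then 1 else -1))

@[simp] theorem run_zero : run A 0 = [] := rfl

theorem red_replicate (m : ℕ) (t : ℤˣ) :
    red (List.replicate m (Sum.inr t) : List (Letter A)) = markPow A (m * t) := by
  induction m with
  | zero => simp
  | succ m ih =>
    rw [List.replicate_succ, red_cons, ih, red_mark, markPow_mul]
    push_cast
    ring_nf

@[simp] theorem red_run (k : ℤ) : red (run A k) = markPow A k := by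
  rw [run, red_replicate]
  split_ifs with h
  · simp [abs_of_nonneg h]
  · simp [abs_of_neg (not_le.mp h)]

theorem mem_run {k : ℤ} {x : Letter A} (hx : x ∈ run A k) : x.isRight = true := by
  rw [run, List.mem_replicate] at hx
  rw [hx.2]; rfl

theorem red_flatMap_congr {X : Type*} {l : List X} {f g : X → List (Letter A)}
    (h : ∀ x ∈ l, red (f x) = red (g x)) : red (l.flatMap f) = red (l.flatMap g) := by
  induction l with
  | nil => rfl
  | cons a l ih =>
    rw [List.flatMap_cons, List.flatMap_cons, red_append, red_append, h a (by simp),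
      ih fun x hx => h x (List.mem_cons_of_mem _ hx)]

end Reduction

/-! ### From equality of reduced words to semi-welded equivalence. -/

namespace Marked

/-- Induction on the generated congruence. The context `x`, `y` is kept arbitrary because in the
product case one factor is rewritten while the other joins the context. -/
theorem sw_update_of_rel {A : Type} (s : A → ℤˣ) {u v : FreeMonoid (Letter A)}
    (h : ConGen.Rel (CancelRel A) u v) (w : Fin n → List (Letter A)) (i : Fin n)
    (x y : List (Letter A)) :
    Sw ⟨A, s, Function.update w i (x ++ u.toList ++ y)⟩
      ⟨A, s, Function.update w i (x ++ v.toList ++ y)⟩ := by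
  induction h generalizing x y with
  | of u v h =>
    obtain ⟨t⟩ := h
    simpa using sw_cancel s w i x y t
  | refl u => exact Sw.refl _
  | symm _ ih => exact (ih x y).symm
  | trans _ _ ih ih' => exact (ih x y).trans (ih' x y)
  | @mul a b c d _ _ ih ih' =>
    have h1 := ih x (c.toList ++ y)
    have h2 := ih' (x ++ b.toList) y
    simp only [FreeMonoid.toList_mul, List.append_assoc] at h1 h2 ⊢
    exact h1.trans h2

theorem sw_of_red_eq {A : Type} (s : A → ℤˣ) {w w' : Fin n → List (Letter A)}
    (h : ∀ i, red (w i) = red (w' i)) : Sw ⟨A, s, w⟩ ⟨A, s, w'⟩ := by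
  -- The circles are rewritten one at a time.
  have key : ∀ S : Finset (Fin n), Sw ⟨A, s, w⟩ ⟨A, s, fun i => if i ∈ S then w' i else w i⟩ := by
    intro S
    induction S using Finset.induction_on with
    | empty => simpa using Sw.refl _
    | insert i S hi ih =>
      refine ih.trans ?_
      have := sw_update_of_rel s ((Con.eq _).mp (h i))
        (fun i => if i ∈ S then w' i else w i) i [] []
      simp only [FreeMonoid.toList_ofList, List.nil_append, List.append_nil] at this
      convert this using 2
      · ext1 j
        by_cases hj : j = i
        · subst hj; simp [hi]
        · simp [Function.update_of_ne hj]
      · ext1 j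
        by_cases hj : j = i
        · subst hj; simp
        · simp [hj]
  simpa using key Finset.univ

/-- Inserting and cancelling marks and moving the base points. -/
theorem sw_of_red_conj {A : Type} (s : A → ℤˣ) {w w' : Fin n → List (Letter A)} (k : Fin n → ℤ)
    (h : ∀ i, markPow A (k i) * red (w i) = red (w' i) * markPow A (k i)) :
    Sw ⟨A, s, w⟩ ⟨A, s, w'⟩ := by
  -- The hypothesis reads w = μ^(-k) w' μ^k; moving the base point past the first run gives w' μ^k
  -- μ^(-k), which reduces to w'.
  refine (sw_of_red_eq s (w' := fun i => run A (-k i) ++ (w' i ++ run A (k i))) fun i => ?_).trans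
    ((Sw.of_isRotated fun i => List.isRotated_append).trans (sw_of_red_eq s fun i => ?_))
  · rw [red_append, red_append, red_run, red_run, ← h, markPow_mul_assoc]
    simp
  · simp

/-- Redistribute the marks around two neighbouring letters. -/
theorem sw_flatMap_of_next {D : GaussDiagram n} {A : Type} (s : A → ℤˣ)
    {B B' : D.Arrow × Bool → List (Letter A)} {i : Fin n} {e f : D.Arrow × Bool}
    (hn : D.Next i e f) (h : red (B e ++ B f) = red (B' e ++ B' f))
    (hB : ∀ x, x ≠ e → x ≠ f → B x = B' x) :
    Sw ⟨A, s, fun j => (D.word j).flatMap B⟩ ⟨A, s, fun j => (D.word j).flatMap B'⟩ := by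
  obtain ⟨l, hl⟩ := hn
  let w : Fin n → List (D.Arrow × Bool) := Function.update D.word i (e :: f :: l)
  have hw : ∀ j, D.word j ~r w j := fun j => by
    by_cases hj : j = i
    · subst hj; simpa [w] using hl
    · simp only [w, Function.update_of_ne hj]; exact List.IsRotated.refl _
  refine (Sw.of_isRotated fun j => isRotated_flatMap (hw j) B).trans (Sw.trans
    (sw_of_red_eq s fun j => ?_) (Sw.of_isRotated fun j => isRotated_flatMap (hw j) B').symm)
  by_cases hj : j = i
  · subst hj
    have hnd := hl.nodup_iff.mp (D.nodup _)
    simp only [w, Function.update_self, List.flatMap_cons]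
    rw [← List.append_assoc, ← List.append_assoc, red_append, h, red_append (_ ++ _)]
    congr 1
    refine red_flatMap_congr fun x hx => ?_
    rw [hB]
    · rintro rfl; simp [hx] at hnd
    · rintro rfl; simp [hx] at hnd
  · simp only [w, Function.update_of_ne hj]
    refine red_flatMap_congr fun x hx => ?_
    rw [hB]
    · rintro rfl
      exact hj (D.eq_of_mem_word hx (hl.mem_iff.mpr (by simp)))
    · rintro rfl
      exact hj (D.eq_of_mem_word hx (hl.mem_iff.mpr (by simp)))

end Marked

/-! ### Pulling the last component across a crossing by the third Reidemeister move. -/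

section Slide

open Classical in
/-- The permutation of the endpoints in a third Reidemeister move. -/
noncomputable def omega3Perm {X : Type} (a b c : X) : Equiv.Perm (X × Bool) :=
  Equiv.swap (tail a) (tail b) * Equiv.swap (head a) (tail c) * Equiv.swap (head b) (head c)

section

variable {X : Type} {a b c : X}

theorem omega3Perm_apply (hab : a ≠ b) (hac : a ≠ c) (hbc : b ≠ c) :
    omega3Perm a b c (a, true) = (b, true) ∧ omega3Perm a b c (b, true) = (a, true) ∧
    omega3Perm a b c (a, false) = (c, true) ∧ omega3Perm a b c (c, true) = (a, false) ∧
    omega3Perm a b c (b, false) = (c, false) ∧ omega3Perm a b c (c, false) = (b, false) := by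
  simp [omega3Perm, Equiv.swap_apply_def, hab, hac, hbc, hab.symm, hac.symm, hbc.symm]

theorem omega3Perm_apply_of_ne {x : X} (ha : x ≠ a) (hb : x ≠ b) (hc : x ≠ c) (β : Bool) :
    omega3Perm a b c (x, β) = (x, β) := by
  simp [omega3Perm, Equiv.swap_apply_def, ha, hb, hc]

end

open Classical in
/-- Insert a positive mark before or after both endpoints of the arrow `c`. -/
noncomputable def slideLetter {A : Type} (β : Bool) (c : A) : Letter A → List (Letter A)
  | Sum.inl e => if e.1 = c then
      (if β then [Sum.inr 1, Sum.inl e] else [Sum.inl e, Sum.inr 1]) else [Sum.inl e]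
  | Sum.inr t => [Sum.inr t]

open Classical in
/-- Insert the head of a new arrow before or after both endpoints of the arrow `c`. -/
noncomputable def slideEndpoint {A : Type} (β : Bool) (c : A) (e : A × Bool) :
    List ((A ⊕ Bool) × Bool) :=
  if e.1 = c then
    (if β then [head (Sum.inr e.2), (Sum.inl e.1, e.2)]
      else [(Sum.inl e.1, e.2), head (Sum.inr e.2)])
  else [(Sum.inl e.1, e.2)]

/-- The words after inserting two new arrows, with tails on the last circle and heads before the
endpoints of the arrow `c`. -/
noncomputable def slideWord (L : GaussDiagram (n + 1)) (c : L.Arrow) (β : Bool) :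
    Fin (n + 1) → List ((L.Arrow ⊕ Bool) × Bool) :=
  Fin.snoc (α := fun _ => List ((L.Arrow ⊕ Bool) × Bool))
    (fun i => (L.word i.castSucc).flatMap (slideEndpoint true c))
    (tail (Sum.inr β) :: tail (Sum.inr !β) :: (L.word (Fin.last n)).map (Prod.map Sum.inl id))

/-- Each new head is inserted next to one endpoint of `c`. Hypothesis `hc` guarantees that this
endpoint lies on one of the first n circles, where the insertion takes place. -/
theorem sum_occ_slideWord (L : GaussDiagram (n + 1)) {c : L.Arrow}
    (hc : ∀ b, (c, b) ∉ L.word (Fin.last n)) (β : Bool) (e : (L.Arrow ⊕ Bool) × Bool) :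
    ∑ i, occ e (L.slideWord c β i) = 1 := by
  classical
  rw [Fin.sum_univ_castSucc]
  simp only [slideWord, Fin.snoc_castSucc, Fin.snoc_last, occ_cons]
  obtain ⟨a | b', b⟩ := e
  · refine Eq.trans ?_ (sum_occ_word L (a, b))
    rw [Fin.sum_univ_castSucc]
    congr 1
    · refine Finset.sum_congr rfl fun i _ => occ_flatMap_eq (fun x => ?_) _
      unfold slideEndpoint
      split_ifs <;> simp_all [occ_cons, Prod.ext_iff]
    · simp only [Prod.mk.injEq, reduceCtorEq, false_and, if_false, zero_add]
      exact occ_map_eq (fun x => by simp [Prod.ext_iff]) _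
  · rw [occ_eq_zero (l := List.map _ _) (by simp)]
    cases b
    · have h1 := sum_occ_word L (c, b')
      rw [Fin.sum_univ_castSucc, occ_eq_zero (hc b'), add_zero] at h1
      simp only [Prod.mk.injEq, reduceCtorEq, and_false, if_false, add_zero]
      refine Eq.trans ?_ h1
      refine Finset.sum_congr rfl fun i _ => occ_flatMap_eq (fun x => ?_) _
      unfold slideEndpoint
      split_ifs <;> simp_all [occ_cons, Prod.ext_iff]
    · rw [Finset.sum_eq_zero]
      · cases b' <;> cases β <;> simp
      · refine fun i _ => occ_eq_zero fun h => ?_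
        obtain ⟨x, -, h⟩ := List.mem_flatMap.mp h
        unfold slideEndpoint at h
        split_ifs at h <;> simp at h

theorem next_of_mem_slideWord {L : GaussDiagram (n + 1)} {c : L.Arrow} {b : Bool} {i : Fin n}
    (hi : (c, b) ∈ L.word i.castSucc) (β : Bool) :
    ∃ l, L.slideWord c β i.castSucc ~r head (Sum.inr b) :: (Sum.inl c, b) :: l := by
  obtain ⟨x, y, h⟩ := List.append_of_mem hi
  simp only [slideWord, Fin.snoc_castSucc, h]
  rw [List.flatMap_append, List.flatMap_cons]
  refine ⟨y.flatMap (slideEndpoint true c) ++ x.flatMap (slideEndpoint true c),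
    List.isRotated_append.trans (isRotated_of_eq ?_)⟩
  simp [slideEndpoint]

namespace Marked

/-- The last component is the top strand of a triangle whose other two strands cross at `c`. It
meets each of them in a positive mark, before `c` on one side of the move and after `c` on the
other. -/
theorem sw_slide {A : Type} (s : A → ℤˣ) (v : Fin n → List (Letter A)) (c : A) :
    Sw ⟨A, s, fun i => (v i).flatMap (slideLetter true c)⟩
      ⟨A, s, fun i => (v i).flatMap (slideLetter false c)⟩ := by
  classical
  have hwf : ∀ β, WF ⟨A, s, fun i => (v i).flatMap (slideLetter β c)⟩ ↔ WF ⟨A, s, v⟩ := by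
    refine fun β => forall_congr' fun e => Eq.congr (Finset.sum_congr rfl fun i _ => ?_) rfl
    refine occ_flatMap_eq (fun x => ?_) _
    rcases x with x | x
    · cases β <;> by_cases hx : x.1 = c <;> simp [slideLetter, hx, occ_cons]
    · simp [slideLetter, occ_cons]
  refine Sw.of_wf ((hwf _).trans (hwf _).symm) fun hM => ?_
  obtain ⟨L, φ, h⟩ := exists_realizes ((hwf _).mp hM)
  have hc : ∀ b, (h.lift c, b) ∉ L.word (Fin.last n) := fun b hb => by
    have := ((h.last _).mp hb).2
    rw [h.map_lift] at this
    simp at this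
  have hword : ∀ b, ∃ i : Fin n, (h.lift c, b) ∈ L.word i.castSucc := fun b => by
    obtain ⟨i, hi, -⟩ := L.unique (h.lift c, b)
    induction i using Fin.lastCases with
    | last => exact absurd hi (hc b)
    | cast i => exact ⟨i, hi⟩
  -- With `δ = 1` and two positive marks, the third move requires the tails on the top strand to be
  -- met in the order given by the sign of `c`. That order can be prescribed, and `β` does so.
  let β := decide (s c = 1)
  let L₁ : GaussDiagram (n + 1) :=
    ofOcc (Sum.elim L.sign fun _ => 1) (L.slideWord (h.lift c) β) (L.sum_occ_slideWord hc β)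
  let φ₁ : L.Arrow ⊕ Bool → A ⊕ ℤˣ := Sum.elim φ fun _ => Sum.inr 1
  have hφ : ∀ β e, (slideEndpoint β (h.lift c) e).map (readLetter φ₁) =
      slideLetter β c (readLetter φ e) := by
    intro β e
    have h1 := h.eq_lift_iff (x := e.1) (a := c)
    unfold slideEndpoint
    by_cases he : e.1 = h.lift c
    · have he' := h1.mp he
      cases β <;> simp [readLetter, φ₁, h.map_lift, slideLetter, he]
    · rcases hx : φ e.1 with a | t
      · have : a ≠ c := by rintro rfl; exact he (h1.mpr hx)
        simp [he, readLetter, φ₁, hx, slideLetter, this]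
      · simp [he, readLetter, φ₁, hx, slideLetter]
  have hwd : ∀ β (i : Fin n), ((L.word i.castSucc).flatMap (slideEndpoint β (h.lift c))).map
      (readLetter φ₁) ~r (v i).flatMap (slideLetter β c) := by
    intro β i
    refine (isRotated_of_eq ?_).trans (isRotated_flatMap (h.word i) _)
    rw [List.map_flatMap, List.flatMap_map]
    simp only [hφ]
  have hbij : ∀ a, ∃! x, φ₁ x = Sum.inl a := by
    refine fun a => ⟨Sum.inl (h.lift a), h.map_lift a, ?_⟩
    rintro (x | x) hx
    · exact congrArg _ (h.eq_lift_iff.mpr hx)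
    · cases hx
  have hsign : ∀ x, L₁.sign x = Sum.elim s id (φ₁ x) := by
    rintro (x | x)
    · exact h.sign x
    · rfl
  have hlast : ∀ e, e ∈ L.slideWord (h.lift c) β (Fin.last n) ↔
      e.2 = true ∧ (φ₁ e.1).isRight = true := by
    rintro ⟨x | x, b⟩
    · simp only [slideWord, Fin.snoc_last]
      rw [← show _ ↔ b = true ∧ (φ₁ (Sum.inl x)).isRight = true from h.last (x, b)]
      simp [Prod.ext_iff]
    · cases x <;> cases b <;> cases β <;> simp [slideWord, φ₁]
  have h₁ : Realizes L₁ ⟨A, s, fun i => (v i).flatMap (slideLetter true c)⟩ φ₁ := by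
    refine ⟨hbij, hsign, hlast, fun i => ?_⟩
    change (L.slideWord (h.lift c) β i.castSucc).map _ ~r _
    rw [slideWord, Fin.snoc_castSucc]
    exact hwd true i
  -- This swaps each new head with the adjacent endpoint of `c`, as desired. It also exchanges the
  -- two new tails, which leaves the set of endpoints on the last circle unchanged.
  let τ : Equiv.Perm ((L.Arrow ⊕ Bool) × Bool) :=
    omega3Perm (Sum.inr true) (Sum.inr false) (Sum.inl (h.lift c))
  obtain ⟨e₁, e₂, e₃, e₄, e₅, e₆⟩ := omega3Perm_apply (X := L.Arrow ⊕ Bool) (a := Sum.inr true)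
    (b := Sum.inr false) (c := Sum.inl (h.lift c)) (by simp) (by simp) (by simp)
  have hfix : ∀ x ≠ h.lift c, ∀ b, τ (Sum.inl x, b) = (Sum.inl x, b) := fun x hx b =>
    omega3Perm_apply_of_ne (by simp) (by simp) (by simpa using hx) b
  have hτ : ∀ e, (slideEndpoint true (h.lift c) e).map τ = slideEndpoint false (h.lift c) e := by
    rintro ⟨x, b⟩
    unfold slideEndpoint
    by_cases hx : x = h.lift c
    · subst hx
      cases b <;> simp [τ, *]
    · simp [hx, hfix]
  have h₂ : Realizes (L₁.permute τ) ⟨A, s, fun i => (v i).flatMap (slideLetter false c)⟩ φ₁ := by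
    refine ⟨hbij, hsign, fun e => ?_, fun i => ?_⟩
    · change e ∈ (L.slideWord (h.lift c) β (Fin.last n)).map τ ↔ _
      have : ∀ e : (L.Arrow ⊕ Bool) × Bool, (τ e).2 = true ∧ (φ₁ (τ e).1).isRight = true ↔
          e.2 = true ∧ (φ₁ e.1).isRight = true := by
        rintro ⟨x | β, b⟩
        · by_cases hx : x = h.lift c
          · subst hx
            cases b <;> simp [τ, φ₁, h.map_lift, *]
          · rw [hfix x hx]
        · cases β <;> cases b <;> simp [τ, φ₁, h.map_lift, *]
      constructor
      · intro he
        obtain ⟨e, hm, rfl⟩ := List.mem_map.mp he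
        exact (this e).mpr ((hlast e).mp hm)
      · intro he
        refine List.mem_map.mpr ⟨τ.symm e, (hlast _).mpr ((this _).mp ?_), τ.apply_symm_apply e⟩
        exact (τ.apply_symm_apply e).symm ▸ he
    · change ((L.slideWord (h.lift c) β i.castSucc).map τ).map _ ~r _
      rw [slideWord, Fin.snoc_castSucc, List.map_flatMap]
      simp only [hτ]
      exact hwd false i
  refine Sw.of_realizes h₁ h₂ (SemiWelded.of_move (Move.omega3
    ⟨(Sum.inr true : L.Arrow ⊕ Bool), (Sum.inr false : L.Arrow ⊕ Bool),
      (Sum.inl (h.lift c) : L.Arrow ⊕ Bool), 1, ?_, ?_, ?_, ?_, ?_, ?_, Iso.refl _⟩))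
  · exact (by simp : (Sum.inr true : L.Arrow ⊕ Bool) ≠ Sum.inr false)
  · exact (by simp : (Sum.inr true : L.Arrow ⊕ Bool) ≠ Sum.inl (h.lift c))
  · exact (by simp : (Sum.inr false : L.Arrow ⊕ Bool) ≠ Sum.inl (h.lift c))
  · refine ⟨Fin.last n, ?_⟩
    have hs : L₁.sign (Sum.inl (h.lift c) : L.Arrow ⊕ Bool) = s c :=
      (hsign _).trans (congrArg (Sum.elim s id) (h.map_lift c))
    have hl : ∃ l, L.slideWord (h.lift c) β (Fin.last n) =
        tail (Sum.inr β) :: tail (Sum.inr !β) :: l := ⟨_, by rw [slideWord, Fin.snoc_last]⟩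
    obtain ⟨l, hl⟩ := hl
    rw [hs, show L₁.sign (Sum.inr true : L.Arrow ⊕ Bool) = 1 from rfl,
      show L₁.sign (Sum.inr false : L.Arrow ⊕ Bool) = 1 from rfl]
    rcases Int.units_eq_one_or (s c) with hc' | hc'
    · refine Or.inl ⟨by simp [hc'], l, isRotated_of_eq ?_⟩
      exact (by simpa [β, hc'] using hl : L.slideWord (h.lift c) β (Fin.last n) =
        tail (Sum.inr true) :: tail (Sum.inr false) :: l)
    · refine Or.inr ⟨by simp [hc'], l, isRotated_of_eq ?_⟩
      exact (by simpa [β, hc'] using hl : L.slideWord (h.lift c) β (Fin.last n) =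
        tail (Sum.inr false) :: tail (Sum.inr true) :: l)
  · obtain ⟨i, hi⟩ := hword true
    exact ⟨i.castSucc, Or.inl ⟨one_mul _, next_of_mem_slideWord hi β⟩⟩
  · obtain ⟨i, hi⟩ := hword false
    exact ⟨i.castSucc, Or.inl ⟨one_mul _, next_of_mem_slideWord hi β⟩⟩

end Marked

end Slide

/-! ### Canonical marked words -/

section Canonical

variable {A : Type}

/-- The label of the incoming short arc, if that of the over-strand of the crossing `a` is
`t a`. -/
def inLabel (s : A → ℤˣ) (t : A → ℤ) (e : A × Bool) : ℤ := if e.2 then t e.1 else t e.1 - s e.1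

/-- The label of the outgoing short arc, if that of the incoming over-strand of the crossing `a`
is `t a`. -/
def outLabel (s : A → ℤˣ) (t : A → ℤ) (e : A × Bool) : ℤ := if e.2 then t e.1 - s e.1 else t e.1

/-- An endpoint with marks around it that change the label from `0` to the label of the incoming
short arc, and back from the label of the outgoing short arc to `0`. -/
def canonBlock (s : A → ℤˣ) (t : A → ℤ) (e : A × Bool) : List (Letter A) :=
  run A (inLabel s t e) ++ Sum.inl e :: run A (-outLabel s t e)

theorem red_canonBlock (s : A → ℤˣ) (t : A → ℤ) (e : A × Bool) : red (canonBlock s t e) =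
    markPow A (inLabel s t e) * (red [Sum.inl e] * markPow A (-outLabel s t e)) := by
  rw [canonBlock, red_append, red_cons, red_run, red_run]

/-- The marked words with canonical marks. -/
abbrev canon (D : GaussDiagram n) (t : D.Arrow → ℤ) : Marked n :=
  ⟨D.Arrow, D.sign, fun i => (D.word i).flatMap (canonBlock D.sign t)⟩

theorem occ_run (k : ℤ) (e : A × Bool) : occ (Sum.inl e) (run A k) = 0 :=
  occ_eq_zero fun h => by simpa using mem_run h

theorem canon_wf (D : GaussDiagram n) (t : D.Arrow → ℤ) : (canon D t).WF := by
  classical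
  intro e
  rw [← sum_occ_word D e]
  refine Finset.sum_congr rfl fun i _ => occ_flatMap_eq (fun x => ?_) _
  simp [canonBlock, occ_cons, occ_run]

theorem flatMap_slideLetter_run (β : Bool) (c : A) (k : ℤ) :
    (run A k).flatMap (slideLetter β c) = run A k := by
  have : ∀ l : List (Letter A), (∀ x ∈ l, x.isRight = true) → l.flatMap (slideLetter β c) = l := by
    intro l hl
    induction l with
    | nil => rfl
    | cons x l ih =>
      rw [List.flatMap_cons, ih fun y hy => hl y (List.mem_cons_of_mem _ hy)]
      rcases x with x | x
      · simpa using hl (Sum.inl x) (by simp)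
      · rfl
  exact this _ fun x hx => mem_run hx

-- A slide across `c` adds 1 to the exponent before each endpoint of `c` and subtracts 1 from the
-- exponent after it, hence raises all four labels at `c` by 1.
open Classical in
theorem canon_sw_canon_succ (D : GaussDiagram n) (t : D.Arrow → ℤ) (c : D.Arrow) :
    (canon D t).Sw (canon D (Function.update t c (t c + 1))) := by
  -- The extra negative mark after `c` is cancelled when the positive mark is inserted after the
  -- endpoint, giving label `t c`. When the positive mark is inserted before it, the negative one
  -- stays, giving label `t c + 1`.
  let V : D.Arrow × Bool → List (Letter D.Arrow) := fun e =>
    if e.1 = c then run _ (inLabel D.sign t e) ++ Sum.inl e :: Sum.inr (-1) ::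
      run _ (-outLabel D.sign t e)
    else canonBlock D.sign t e
  have hV : ∀ e, red ((V e).flatMap (slideLetter false c)) = red (canonBlock D.sign t e) := by
    intro e
    by_cases he : e.1 = c
    · rw [red_canonBlock]
      simp only [V, he, if_true, List.flatMap_append, flatMap_slideLetter_run, List.flatMap_cons,
        slideLetter, Bool.false_eq_true, if_false, red_append, red_run, List.cons_append,
        List.nil_append]
      rw [red_cons, red_cons (Sum.inr 1), red_cons (Sum.inr (-1)), red_run, red_mark, red_mark,
        markPow_mul_assoc]
      simp
    · simp [V, he, canonBlock, flatMap_slideLetter_run, slideLetter]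
  have hV' : ∀ e, red ((V e).flatMap (slideLetter true c)) =
      red (canonBlock D.sign (Function.update t c (t c + 1)) e) := by
    intro e
    by_cases he : e.1 = c
    · have h1 : inLabel D.sign (Function.update t c (t c + 1)) e = inLabel D.sign t e + 1 := by
        unfold inLabel; rw [he]; split_ifs <;> simp; ring
      have h2 : outLabel D.sign (Function.update t c (t c + 1)) e = outLabel D.sign t e + 1 := by
        unfold outLabel; rw [he]; split_ifs <;> simp; ring
      rw [red_canonBlock, h1, h2]
      simp only [V, he, if_true, List.flatMap_append, flatMap_slideLetter_run, List.flatMap_cons,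
        slideLetter, red_append, red_run, List.cons_append, List.nil_append]
      rw [red_cons, red_cons (Sum.inl e), red_cons (Sum.inr (-1)), red_run, red_mark, red_mark,
        Units.val_one, Units.val_neg, Units.val_one, markPow_mul_assoc, markPow_mul, neg_add,
        add_comm (-1 : ℤ)]
    · have h1 : inLabel D.sign (Function.update t c (t c + 1)) e = inLabel D.sign t e := by
        simp [inLabel, he]
      have h2 : outLabel D.sign (Function.update t c (t c + 1)) e = outLabel D.sign t e := by
        simp [outLabel, he]
      simp [V, he, canonBlock, flatMap_slideLetter_run, slideLetter, h1, h2]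
  have h := Marked.sw_slide D.sign (fun i => (D.word i).flatMap V) c
  simp only [List.flatMap_assoc] at h
  exact ((Marked.sw_of_red_eq _ fun i => red_flatMap_congr fun e _ => hV e).symm.trans
    h.symm).trans (Marked.sw_of_red_eq _ fun i => red_flatMap_congr fun e _ => hV' e)

open Classical in
theorem canon_sw_canon_update (D : GaussDiagram n) (t : D.Arrow → ℤ) (c : D.Arrow) (k : ℤ) :
    (canon D t).Sw (canon D (Function.update t c k)) := by
  induction k using Int.inductionOn' (b := t c) with
  | zero => rw [Function.update_eq_self]; exact Marked.Sw.refl _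
  | succ k _ ih =>
    refine ih.trans ?_
    simpa using canon_sw_canon_succ D (Function.update t c k) c
  | pred k _ ih =>
    refine ih.trans (Marked.Sw.symm ?_)
    simpa using canon_sw_canon_succ D (Function.update t c (k - 1)) c

theorem canon_sw_canon (D : GaussDiagram n) (t t' : D.Arrow → ℤ) : (canon D t).Sw (canon D t') := by
  classical
  have key : ∀ S : Finset D.Arrow,
      (canon D t).Sw (canon D fun a => if a ∈ S then t' a else t a) := by
    intro S
    induction S using Finset.induction_on with
    | empty => simpa using Marked.Sw.refl _
    | insert a S ha ih =>
      refine ih.trans ?_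
      convert canon_sw_canon_update D _ a (t' a) using 2
      ext b
      by_cases hb : b = a
      · subst hb; simp
      · simp [hb]
  -- Every arrow occurs in one of finitely many finite words, so this finite set contains all
  -- arrows.
  have h := key (Finset.univ.biUnion fun i => ((D.word i).map Prod.fst).toFinset)
  convert h using 2
  ext a
  rw [if_pos]
  obtain ⟨i, hi, -⟩ := D.unique (a, true)
  simp only [Finset.mem_biUnion, Finset.mem_univ, true_and, List.mem_toFinset, List.mem_map]
  exact ⟨i, (a, true), hi, rfl⟩

theorem Marked.sw_of_equiv {A A' : Type} {s : A → ℤˣ} {s' : A' → ℤˣ}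
    {w : Fin n → List (Letter A)} {w' : Fin n → List (Letter A')} (f : A ≃ A')
    (hs : ∀ a, s' (f a) = s a) (hM : WF ⟨A, s, w⟩)
    (hw : ∀ i, (w i).map (Sum.map (Prod.map f id) id) ~r w' i) :
    Sw ⟨A, s, w⟩ ⟨A', s', w'⟩ := by
  obtain ⟨L, φ, hL⟩ := Marked.exists_realizes hM
  change L.Arrow → A ⊕ ℤˣ at φ
  refine Marked.Sw.of_realizes hL (⟨fun a => ?_, fun x => ?_, fun e => ?_, fun i => ?_⟩ :
    Realizes L ⟨A', s', w'⟩ fun x => Sum.map f id (φ x)) (SemiWelded.refl L)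
  · have hf : ∀ x, Sum.map f id (φ x) = Sum.inl a ↔ φ x = Sum.inl (f.symm a) := fun x => by
      rcases φ x with y | y
      · simp [Equiv.eq_symm_apply]
      · simp
    simp only [hf]
    exact hL.bij _
  · rw [hL.sign]
    rcases φ x with y | y
    · exact (hs y).symm
    · rfl
  · rw [hL.last]
    rcases φ e.1 with y | y <;> simp
  · refine (isRotated_of_eq ?_).trans (((hL.word i).map _).trans (hw i))
    rw [List.map_map]
    refine List.map_congr_left fun e _ => ?_
    simp only [Function.comp, readLetter]
    rcases φ e.1 with y | y <;> rfl

theorem canon_sw_of_iso {D D' : GaussDiagram n} (h : D.Iso D') :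
    (canon D fun _ => 0).Sw (canon D' fun _ => 0) := by
  obtain ⟨f, hs, hw⟩ := h
  refine Marked.sw_of_equiv f hs (canon_wf D _) fun i => ?_
  refine (isRotated_of_eq ?_).trans (isRotated_flatMap (hw i) _)
  rw [List.map_flatMap, List.flatMap_map]
  have hrun : ∀ k, (run D.Arrow k).map (Sum.map (Prod.map f id) id) = run D'.Arrow k := by
    intro k; simp [run]
  refine List.flatMap_congr fun e _ => ?_
  simp only [canonBlock, List.map_append, List.map_cons, hrun, inLabel, outLabel, Prod.map_fst,
    hs, Prod.map_snd, id_eq, Sum.map_inl]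

end Canonical

/-! ### Reidemeister moves on canonical marked words -/

/-! ### Removing the marks between chosen neighbours. -/

section Opened

variable {A : Type}

open Classical in
/-- The list `l`, or the empty list if `c` holds. -/
noncomputable def dropIf (c : Prop) {X : Type*} (l : List X) : List X := if c then [] else l

theorem dropIf_pos {c : Prop} (h : c) {X : Type*} (l : List X) : dropIf c l = [] := if_pos h

theorem dropIf_neg {c : Prop} (h : ¬c) {X : Type*} (l : List X) : dropIf c l = l := if_neg h

/-- Canonical marks, except that there are none between the two endpoints of each pair in `ps`. -/
noncomputable def openBlock (s : A → ℤˣ) (t : A → ℤ) (ps : List ((A × Bool) × (A × Bool)))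
    (e : A × Bool) : List (Letter A) :=
  dropIf (e ∈ ps.map Prod.snd) (run A (inLabel s t e)) ++
    Sum.inl e :: dropIf (e ∈ ps.map Prod.fst) (run A (-outLabel s t e))

theorem ne_of_next {D : GaussDiagram n} {i : Fin n} {e f : D.Arrow × Bool} (h : D.Next i e f) :
    e ≠ f := by
  obtain ⟨l, hl⟩ := h
  have := hl.nodup_iff.mp (D.nodup i)
  rintro rfl
  simp at this

/-- Between neighbours e, f the canonical marks are μ^(-out(e)) μ^(in(f)), which is trivial when the
two labels agree. The `Nodup` hypotheses ensure that no side of an endpoint is cleared twice. -/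
theorem canon_sw_openBlock (D : GaussDiagram n) (t : D.Arrow → ℤ)
    (ps : List ((D.Arrow × Bool) × (D.Arrow × Bool))) (h₁ : (ps.map Prod.fst).Nodup)
    (h₂ : (ps.map Prod.snd).Nodup) (hn : ∀ p ∈ ps, ∃ i, D.Next i p.1 p.2)
    (ht : ∀ p ∈ ps, outLabel D.sign t p.1 = inLabel D.sign t p.2) :
    (canon D t).Sw ⟨D.Arrow, D.sign, fun i => (D.word i).flatMap (openBlock D.sign t ps)⟩ := by
  induction ps with
  | nil =>
    have : openBlock D.sign t [] = canonBlock D.sign t := by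
      ext1 e; simp [openBlock, canonBlock, dropIf]
    rw [this]
    exact Marked.Sw.refl _
  | cons p ps ih =>
    obtain ⟨e, f⟩ := p
    simp only [List.map_cons, List.nodup_cons] at h₁ h₂
    refine (ih h₁.2 h₂.2 (fun p hp => hn p (List.mem_cons_of_mem _ hp))
      (fun p hp => ht p (List.mem_cons_of_mem _ hp))).trans ?_
    obtain ⟨i, hi⟩ := hn _ List.mem_cons_self
    have hef := ne_of_next hi
    have hlab := ht _ List.mem_cons_self
    dsimp only at hi hef hlab
    have m₁ : ∀ x, x ≠ e → (x ∈ ((e, f) :: ps).map Prod.fst) =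
        (x ∈ ps.map Prod.fst) := fun x hx => by
      rw [List.map_cons, List.mem_cons, or_iff_right hx]
    have m₂ : ∀ x, x ≠ f → (x ∈ ((e, f) :: ps).map Prod.snd) =
        (x ∈ ps.map Prod.snd) := fun x hx => by
      rw [List.map_cons, List.mem_cons, or_iff_right hx]
    refine Marked.sw_flatMap_of_next D.sign hi ?_ fun x hxe hxf => ?_
    · have n₁ : e ∈ ((e, f) :: ps).map Prod.fst := List.mem_cons_self
      have n₂ : f ∈ ((e, f) :: ps).map Prod.snd := List.mem_cons_self
      unfold openBlock
      rw [dropIf_neg h₁.1, dropIf_neg h₂.1, dropIf_pos n₁, dropIf_pos n₂, m₁ f hef.symm, m₂ e hef,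
        hlab]
      simp only [red_append, red_run, List.nil_append]
      rw [red_cons, red_run]
      simp [mul_assoc]
    · unfold openBlock
      rw [m₁ x hxe, m₂ x hxf]

/-- Once no mark separates them, neighbours in `D` are neighbours in the realization too, which is
what a Reidemeister move there requires. -/
theorem Realizes.next_of_mem {D : GaussDiagram n} {t : D.Arrow → ℤ}
    {ps : List ((D.Arrow × Bool) × (D.Arrow × Bool))} {L : GaussDiagram (n + 1)}
    {φ : L.Arrow → D.Arrow ⊕ ℤˣ}
    (h : Realizes L ⟨D.Arrow, D.sign, fun i => (D.word i).flatMap (openBlock D.sign t ps)⟩ φ)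
    {e f : D.Arrow × Bool} (hp : (e, f) ∈ ps) {i : Fin n} (hi : D.Next i e f) :
    L.Next i.castSucc (h.liftEnd e) (h.liftEnd f) := by
  obtain ⟨l, hl⟩ := hi
  have he : e ∈ ps.map Prod.fst := List.mem_map.mpr ⟨_, hp, rfl⟩
  have hf : f ∈ ps.map Prod.snd := List.mem_map.mpr ⟨_, hp, rfl⟩
  have h1 := isRotated_flatMap hl (openBlock D.sign t ps)
  rw [List.flatMap_cons, List.flatMap_cons, openBlock, dropIf_pos he, openBlock, dropIf_pos hf,
    List.append_assoc, List.nil_append] at h1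
  exact h.next_lift (h1.trans List.isRotated_append)

end Opened

/-! ### Deleting arrows of D while keeping all marks. -/

section Restriction

variable {A : Type}

open Classical in
/-- Delete the letters of the arrows that do not satisfy `p`. -/
noncomputable def keepLetters (p : A → Prop) (w : List (Letter A)) : List (Letter {a // p a}) :=
  w.filterMap (Sum.elim (fun e => if h : p e.1 then some (Sum.inl (⟨e.1, h⟩, e.2)) else none)
    fun t => some (Sum.inr t))

theorem keepLetters_append (p : A → Prop) (w w' : List (Letter A)) :
    keepLetters p (w ++ w') = keepLetters p w ++ keepLetters p w' :=
  List.filterMap_append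

theorem keepLetters_cons_mark (p : A → Prop) (t : ℤˣ) (w : List (Letter A)) :
    keepLetters p (Sum.inr t :: w) = Sum.inr t :: keepLetters p w := by
  simp [keepLetters]

theorem keepLetters_cons_pos {p : A → Prop} {e : A × Bool} (h : p e.1) (w : List (Letter A)) :
    keepLetters p (Sum.inl e :: w) = Sum.inl (⟨e.1, h⟩, e.2) :: keepLetters p w := by
  simp [keepLetters, h]

theorem keepLetters_cons_neg {p : A → Prop} {e : A × Bool} (h : ¬p e.1) (w : List (Letter A)) :
    keepLetters p (Sum.inl e :: w) = keepLetters p w := by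
  simp [keepLetters, h]

theorem keepLetters_run (p : A → Prop) (k : ℤ) : keepLetters p (run A k) = run _ k := by
  unfold run
  induction k.natAbs with
  | zero => rfl
  | succ m ih => rw [List.replicate_succ, keepLetters_cons_mark, ih, List.replicate_succ]

theorem map_keep_readLetter {X : Type} {φ : X → A ⊕ ℤˣ} {P : X → Prop} {p : A → Prop}
    (hP : ∀ x, P x ↔ ∀ a, φ x = Sum.inl a → p a) {ψ : {x // P x} → {a // p a} ⊕ ℤˣ}
    (hψ : ∀ x, Sum.map Subtype.val id (ψ x) = φ x.1) (u : List (X × Bool)) :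
    (keep P u).map (readLetter ψ) = keepLetters p (u.map (readLetter φ)) := by
  induction u with
  | nil => rfl
  | cons e u ih =>
    rw [List.map_cons]
    rcases hx : φ e.1 with a | t
    · have hr : readLetter φ e = Sum.inl (a, e.2) := readLetter_eq_inl.mpr ⟨hx, rfl⟩
      by_cases he : P e.1
      · have ha : p a := (hP _).mp he a hx
        have h1 : keep P (e :: u) = (⟨e.1, he⟩, e.2) :: keep P u := by simp [keep, he]
        have h2 := hψ ⟨e.1, he⟩
        rw [h1, List.map_cons, hr, keepLetters_cons_pos ha, ih]
        congr 1
        rw [readLetter_eq_inl]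
        refine ⟨?_, rfl⟩
        rw [hx] at h2
        rcases hy : ψ ⟨e.1, he⟩ with b | b
        · rw [hy] at h2
          exact congrArg _ (Subtype.ext (Sum.inl_injective h2))
        · rw [hy] at h2
          cases h2
      · have ha : ¬p a := fun ha => he ((hP _).mpr fun b hb => by
          rw [hx] at hb; rwa [← Sum.inl_injective hb])
        rw [keep_cons_of_not he, hr, keepLetters_cons_neg ha, ih]
    · have hr : readLetter φ e = Sum.inr t := readLetter_eq_inr.mpr hx
      have he : P e.1 := (hP _).mpr fun a ha => by rw [hx] at ha; cases ha
      have h1 : keep P (e :: u) = (⟨e.1, he⟩, e.2) :: keep P u := by simp [keep, he]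
      have h2 := hψ ⟨e.1, he⟩
      rw [h1, List.map_cons, hr, keepLetters_cons_mark, ih]
      congr 1
      rw [readLetter_eq_inr]
      rw [hx] at h2
      rcases hy : ψ ⟨e.1, he⟩ with b | b
      · rw [hy] at h2
        cases h2
      · rw [hy] at h2
        exact congrArg _ (Sum.inr_injective h2)

theorem Realizes.exists_restrict {s : A → ℤˣ} {w : Fin n → List (Letter A)}
    {L : GaussDiagram (n + 1)} {φ : L.Arrow → A ⊕ ℤˣ} (h : Realizes L ⟨A, s, w⟩ φ)
    {P : L.Arrow → Prop} {p : A → Prop} (hP : ∀ x, P x ↔ ∀ a, φ x = Sum.inl a → p a) :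
    ∃ ψ, Realizes (L.restrict P) ⟨{a // p a}, fun a => s a, fun i => keepLetters p (w i)⟩ ψ := by
  have hex : ∀ x : {x // P x}, ∃ y : {a // p a} ⊕ ℤˣ, Sum.map Subtype.val id y = φ x.1 := by
    rintro ⟨x, hx⟩
    rcases hy : φ x with a | t
    · exact ⟨Sum.inl ⟨a, (hP x).mp hx a hy⟩, rfl⟩
    · exact ⟨Sum.inr t, rfl⟩
  choose ψ hψ using hex
  have hl : ∀ x (a : {a // p a}), ψ x = Sum.inl a ↔ φ x.1 = Sum.inl a.1 := by
    intro x a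
    rw [← hψ]
    rcases ψ x with y | y
    · simp [Subtype.ext_iff]
    · simp
  refine ⟨ψ, h.restrict (M' := ⟨{a // p a}, fun a => s a, fun i => keepLetters p (w i)⟩) P ψ
    (fun a => ?_) (fun x => ?_) (fun x => ?_) fun i => ?_⟩
  · refine ⟨⟨h.lift a.1, (hP _).mpr fun b hb => ?_⟩, (hl _ _).mpr (h.map_lift _), fun x hx => ?_⟩
    · rw [h.map_lift] at hb
      rw [← Sum.inl_injective hb]
      exact a.2
    · exact Subtype.ext (h.eq_lift_iff.mpr ((hl _ _).mp hx))
  · rw [h.sign, ← hψ]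
    rcases ψ x with y | y <;> rfl
  · rw [← hψ]
    rcases ψ x with y | y <;> rfl
  · refine ⟨_, List.IsRotated.refl _, ?_⟩
    rw [map_keep_readLetter hP hψ]
    exact isRotated_filterMap (h.word i) _

theorem keepLetters_canonBlock {p : A → Prop} (s : A → ℤˣ) (t : A → ℤ) {e : A × Bool}
    (h : p e.1) : keepLetters p (canonBlock s t e) =
      canonBlock (fun a : {a // p a} => s a) (fun a => t a) (⟨e.1, h⟩, e.2) := by
  rw [canonBlock, keepLetters_append, keepLetters_run, keepLetters_cons_pos h, keepLetters_run]
  rfl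

theorem flatMap_keep {p : A → Prop} {Y : Type*} (g : {a // p a} × Bool → List Y)
    {f : A × Bool → List Y} (hf : ∀ e (h : p e.1), f e = g (⟨e.1, h⟩, e.2))
    (hf' : ∀ e, ¬p e.1 → f e = []) (w : List (A × Bool)) : (keep p w).flatMap g = w.flatMap f := by
  induction w with
  | nil => rfl
  | cons e w ih =>
    by_cases he : p e.1
    · have h1 : keep p (e :: w) = (⟨e.1, he⟩, e.2) :: keep p w := by simp [keep, he]
      rw [h1, List.flatMap_cons, List.flatMap_cons, ih, hf e he]
    · rw [keep_cons_of_not he, List.flatMap_cons, ih, hf' e he, List.nil_append]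

theorem keepLetters_flatMap {X : Type*} (p : A → Prop) (f : X → List (Letter A)) (w : List X) :
    keepLetters p (w.flatMap f) = w.flatMap fun x => keepLetters p (f x) :=
  List.filterMap_flatMap

theorem canon_restrict_sw {D : GaussDiagram n} (p : D.Arrow → Prop) (t : D.Arrow → ℤ)
    {f : D.Arrow × Bool → List (Letter {a // p a})}
    (hf : ∀ e, p e.1 → f e = keepLetters p (canonBlock D.sign t e))
    (hf' : ∀ e, ¬p e.1 → f e = []) :
    Marked.Sw ⟨{a // p a}, fun a => D.sign a, fun i => (D.word i).flatMap f⟩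
      (canon (D.restrict p) fun _ => 0) := by
  refine Marked.Sw.trans ?_ (canon_sw_canon (D.restrict p) (fun a : {a // p a} => t a) _)
  have : ∀ i, (keep p (D.word i)).flatMap (canonBlock (fun a : {a // p a} => D.sign a)
      (fun a => t a)) = (D.word i).flatMap f := fun i =>
    flatMap_keep _ (fun e he => by rw [hf e he, keepLetters_canonBlock]) hf' _
  simp only [← this]
  exact Marked.Sw.refl _

end Restriction

/-- The label of the removed crossing is chosen so that the strand enters and leaves the kink with
label 0. The labels agree inside the kink, so there are no marks left when the arrow disappears. -/
theorem canon_sw_of_omega1 {D D' : GaussDiagram n} (h : D.Omega1 D') :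
    (canon D fun _ => 0).Sw (canon D' fun _ => 0) := by
  obtain ⟨a, i, hi, hiso⟩ := h
  refine Marked.Sw.trans ?_ (canon_sw_of_iso hiso).symm
  have key : ∀ (t : ℤ) (b : Bool), D.Next i (a, b) (a, !b) →
      inLabel D.sign (fun _ => t) (a, b) = 0 →
      outLabel D.sign (fun _ => t) (a, b) = inLabel D.sign (fun _ => t) (a, !b) →
      outLabel D.sign (fun _ => t) (a, !b) = 0 →
      (canon D fun _ => 0).Sw (canon (D.restrict fun x => x ≠ a) fun _ => 0) := by
    intro t b hn h1 h2 h3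
    refine ((canon_sw_canon D _ fun _ => t).trans (canon_sw_openBlock D _ [((a, b), (a, !b))]
      (by simp) (by simp) (by simpa using ⟨i, hn⟩) (by simpa using h2))).trans ?_
    have hwf := (canon_sw_openBlock D (fun _ => t) [((a, b), (a, !b))]
      (by simp) (by simp) (by simpa using ⟨i, hn⟩) (by simpa using h2)).1.mp (canon_wf D _)
    obtain ⟨L, φ, hL⟩ := Marked.exists_realizes hwf
    have hnext := hL.next_of_mem (by simp) hn
    obtain ⟨ψ, hψ⟩ := hL.exists_restrict (P := fun x => x ≠ hL.lift a) (p := fun x => x ≠ a)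
      fun x => by
        rw [Ne, hL.eq_lift_iff]
        constructor
        · rintro hx b hb rfl; exact hx hb
        · intro hx hb; exact hx a hb rfl
    refine (Marked.Sw.of_realizes hL hψ (SemiWelded.of_move (Move.omega1
      ⟨hL.lift a, i.castSucc, ?_, Iso.refl _⟩))).trans ?_
    · cases b
      · exact Or.inr hnext
      · exact Or.inl hnext
    · simp only [keepLetters_flatMap]
      refine canon_restrict_sw _ (fun _ => t) (fun e he => ?_) fun e he => ?_
      · have he1 : e ≠ (a, b) := by rintro rfl; exact he rfl
        have he2 : e ≠ (a, !b) := by rintro rfl; exact he rfl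
        simp [openBlock, canonBlock, dropIf, he1, he2]
      · have he' : e = (a, b) ∨ e = (a, !b) := by
          obtain ⟨x, c⟩ := e
          obtain rfl : x = a := not_not.mp he
          cases b <;> cases c <;> simp
        rcases he' with rfl | rfl
        · rw [openBlock, keepLetters_append, keepLetters_cons_neg he, h1,
              dropIf_pos (c := _ ∈ List.map Prod.fst _) (by simp)]
          simp [dropIf, keepLetters]
        · rw [openBlock, keepLetters_append, keepLetters_cons_neg he, h3,
              dropIf_pos (c := _ ∈ List.map Prod.snd _) (by simp)]
          simp [dropIf, keepLetters]
  rcases hi with hi | hi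
  -- The incoming label is `t` at a tail and `t - D.sign a` at a head; its vanishing forces `t = 0`
  -- or `t = D.sign a`, according to which endpoint comes first.
  · exact key 0 true hi (by simp [inLabel]) (by simp [inLabel, outLabel]) (by simp [outLabel])
  · exact key (D.sign a) false hi (by simp [inLabel]) (by simp [inLabel, outLabel])
      (by simp [outLabel])

theorem keepLetters_openBlock_of_not {A : Type} {p : A → Prop} (s : A → ℤˣ) (t : A → ℤ)
    (ps : List ((A × Bool) × (A × Bool))) {e : A × Bool} (he : ¬p e.1) :
    keepLetters p (openBlock s t ps e) =
      dropIf (e ∈ ps.map Prod.snd) (run _ (inLabel s t e)) ++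
        dropIf (e ∈ ps.map Prod.fst) (run _ (-outLabel s t e)) := by
  have hd : ∀ (c : Prop) (k : ℤ), keepLetters p (dropIf c (run A k)) = dropIf c (run _ k) := by
    intro c k
    by_cases hc : c
    · rw [dropIf_pos hc, dropIf_pos hc]; rfl
    · rw [dropIf_neg hc, dropIf_neg hc, keepLetters_run]
  rw [openBlock, keepLetters_append, keepLetters_cons_neg he, hd, hd]

/-- The opposite signs allow the labels to agree on both inner arcs simultaneously, for either order
of the heads. Whatever marks remain around the removed pairs have total exponent 0. -/
theorem canon_sw_of_omega2 {D D' : GaussDiagram n} (h : D.Omega2 D') :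
    (canon D fun _ => 0).Sw (canon D' fun _ => 0) := by
  classical
  obtain ⟨a, b, i, j, hs, hi, hj, hiso⟩ := h
  refine Marked.Sw.trans ?_ (canon_sw_of_iso hiso).symm
  have hab : a ≠ b := fun h => ne_of_next hi (by rw [h])
  have hs' : (D.sign a : ℤ) = -D.sign b := by rw [hs]; simp
  -- On the over-strand the labels are then 0, `D.sign b`, 0. On the under-strand they are `D.sign
  -- b`, 0, `D.sign b` if the head of `a` comes first, and 0, `D.sign b`, 0 otherwise.
  let t : D.Arrow → ℤ := fun x => if x = b then D.sign b else 0
  have key : ∀ q : (D.Arrow × Bool) × (D.Arrow × Bool), D.Next j q.1 q.2 →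
      (q = (head a, head b) ∨ q = (head b, head a)) →
      (canon D fun _ => 0).Sw (canon (D.restrict fun x => x ≠ a ∧ x ≠ b) fun _ => 0) := by
    intro q hn hq
    have hop := canon_sw_openBlock D t [(tail a, tail b), q]
      (by rcases hq with rfl | rfl <;> simp) (by rcases hq with rfl | rfl <;> simp)
      (by simpa using ⟨⟨i, hi⟩, ⟨j, hn⟩⟩)
      (by rcases hq with rfl | rfl <;> simp [inLabel, outLabel, t, hab, hs'])
    refine (canon_sw_canon D _ t).trans (hop.trans ?_)
    obtain ⟨L, φ, hL⟩ := Marked.exists_realizes (hop.1.mp (canon_wf D _))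
    have hn1 := hL.next_of_mem (by simp) hi
    have hn2 := hL.next_of_mem (e := q.1) (f := q.2) (by simp) hn
    obtain ⟨ψ, hψ⟩ := hL.exists_restrict (P := fun x => x ≠ hL.lift a ∧ x ≠ hL.lift b)
      (p := fun x => x ≠ a ∧ x ≠ b) fun x => by
        rw [Ne, Ne, hL.eq_lift_iff, hL.eq_lift_iff]
        constructor
        · rintro ⟨hx, hx'⟩ c hc
          exact ⟨by rintro rfl; exact hx hc, by rintro rfl; exact hx' hc⟩
        · intro hx
          exact ⟨fun hc => (hx a hc).1 rfl, fun hc => (hx b hc).2 rfl⟩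
    refine (Marked.Sw.of_realizes hL hψ (SemiWelded.of_move (Move.omega2
      ⟨hL.lift a, hL.lift b, i.castSucc, j.castSucc, ?_, hn1, ?_, Iso.refl _⟩))).trans ?_
    · rw [hL.sign, hL.sign, hL.map_lift, hL.map_lift]
      exact hs
    · rcases hq with rfl | rfl
      · exact Or.inl hn2
      · exact Or.inr hn2
    simp only [keepLetters_flatMap]
    refine Marked.Sw.trans ?_ (canon_restrict_sw (fun x => x ≠ a ∧ x ≠ b) t (f := fun e =>
      if e.1 ≠ a ∧ e.1 ≠ b then keepLetters _ (canonBlock D.sign t e) else [])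
      (fun e he => if_pos he) fun e he => if_neg he)
    -- Only the pair of heads may leave marks behind, namely two runs with opposite exponents, which
    -- become neighbours and cancel.
    refine Marked.sw_flatMap_of_next _ hn ?_ fun e he1 he2 => ?_
    · have h1 : ∀ e, (e = head a ∨ e = head b) → ¬(e.1 ≠ a ∧ e.1 ≠ b) := by
        rintro e (rfl | rfl) <;> simp
      rcases hq with rfl | rfl
      · rw [keepLetters_openBlock_of_not _ _ _ (h1 _ (by simp)),
          keepLetters_openBlock_of_not _ _ _ (h1 _ (by simp))]
        simp [dropIf, inLabel, outLabel, t, hab, hab.symm, hs']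
      · rw [keepLetters_openBlock_of_not _ _ _ (h1 _ (by simp)),
          keepLetters_openBlock_of_not _ _ _ (h1 _ (by simp))]
        simp [dropIf, inLabel, outLabel, t, hab, hab.symm]
    · by_cases he : e.1 ≠ a ∧ e.1 ≠ b
      · have he3 : e ≠ tail a := by rintro rfl; exact he.1 rfl
        have he4 : e ≠ tail b := by rintro rfl; exact he.2 rfl
        rw [if_pos he]
        simp [openBlock, canonBlock, dropIf, he1, he2, he3, he4]
      · have he' : e = tail a ∨ e = tail b := by
          obtain ⟨x, c⟩ := e
          cases c <;> rcases hq with rfl | rfl <;> grind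
        rw [if_neg he, keepLetters_openBlock_of_not _ _ _ he]
        rcases he' with rfl | rfl <;> simp [dropIf, inLabel, outLabel, t, hab, hab.symm]
  rcases hj with hj | hj
  · exact key _ hj (Or.inl rfl)
  · exact key _ hj (Or.inr rfl)

/-! ### Canonical words under the third Reidemeister move. -/

section ThirdMove

variable {A : Type}

open Classical in
/-- Two neighbours in the order in which they are met. -/
noncomputable def orient {X : Type*} (s : ℤˣ) (x y : X) : X × X := if s = 1 then (x, y) else (y, x)

theorem orient_one {X : Type*} (x y : X) : orient 1 x y = (x, y) := if_pos rfl

theorem orient_neg_one {X : Type*} (x y : X) : orient (-1) x y = (y, x) := if_neg (by decide)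

theorem consecutive_iff (D : GaussDiagram n) (s : ℤˣ) (e f : D.Arrow × Bool) :
    D.Consecutive s e f ↔ ∃ i, D.Next i (orient s e f).1 (orient s e f).2 := by
  have h1 : (1 : ℤˣ) ≠ -1 := by decide
  rcases Int.units_eq_one_or s with rfl | rfl
  · simp [Consecutive, orient_one, h1]
  · simp [Consecutive, orient_neg_one, h1.symm]

/-- The three pairs of neighbouring crossings in a third Reidemeister move. -/
noncomputable def trianglePairs (s : A → ℤˣ) (δ : ℤˣ) (a b c : A) :
    List ((A × Bool) × (A × Bool)) :=
  [orient (δ * s a * s b * s c) (tail a) (tail b), orient (δ * s a) (head a) (tail c),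
    orient (δ * s b) (head b) (head c)]

/-- Labels `t` before and `t'` after the move: they agree along each inner arc of the triangle, and
the labels where the strands enter and leave the triangle are unchanged. The relation between the
signs and the orders along the strands makes these equations compatible. -/
theorem exists_triangle_labels (s : A → ℤˣ) (δ : ℤˣ) {a b c : A} (hab : a ≠ b) (hac : a ≠ c)
    (hbc : b ≠ c) : ∃ t t' : A → ℤ, (∀ x, x ≠ a → x ≠ b → x ≠ c → t' x = t x) ∧
      ∀ p ∈ trianglePairs s δ a b c, outLabel s t p.1 = inLabel s t p.2 ∧
        inLabel s t' p.2 = inLabel s t p.1 ∧ outLabel s t' p.1 = outLabel s t p.2 ∧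
        outLabel s t' p.2 = inLabel s t' p.1 := by
  classical
  have key : ∃ ta tb tc ta' tb' tc' : ℤ, ∀ t t' : A → ℤ, t a = ta → t b = tb → t c = tc →
      t' a = ta' → t' b = tb' → t' c = tc' →
      ∀ p ∈ trianglePairs s δ a b c, outLabel s t p.1 = inLabel s t p.2 ∧
        inLabel s t' p.2 = inLabel s t p.1 ∧ outLabel s t' p.1 = outLabel s t p.2 ∧
        outLabel s t' p.2 = inLabel s t' p.1 := by
    let s₁ := δ * s a * s b * s c
    let s₂ := δ * s a
    -- After the normalization `t a = 0`, the inner arc of the top strand determines `t b` and that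
    -- of the middle strand determines `t c`. The outer labels then determine `t'`. The equations
    -- not used for solving are checked over all signs.
    refine ⟨0, if s₁ = 1 then -s a else s b, if s₂ = 1 then 0 else s c - s a,
      if s₁ = 1 then -s b else s b, if s₁ = 1 then 0 else s b - s a,
      if s₂ = 1 then -s a else if s₁ = 1 then -s b else s b, fun t t' h1 h2 h3 h4 h5 h6 => ?_⟩
    simp only [trianglePairs, List.mem_cons, List.not_mem_nil, or_false, forall_eq_or_imp,
      forall_eq]
    have hn : (-1 : ℤˣ) ≠ 1 := by decide
    rcases Int.units_eq_one_or δ with rfl | rfl <;>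
    rcases Int.units_eq_one_or (s a) with ha | ha <;>
    rcases Int.units_eq_one_or (s b) with hb | hb <;>
    rcases Int.units_eq_one_or (s c) with hc | hc <;>
    simp [s₁, s₂, ha, hb, hc, hn, orient_one, orient_neg_one, inLabel, outLabel, h1, h2, h3, h4,
      h5, h6]
  obtain ⟨ta, tb, tc, ta', tb', tc', h⟩ := key
  refine ⟨fun x => if x = a then ta else if x = b then tb else if x = c then tc else 0,
    fun x => if x = a then ta' else if x = b then tb' else if x = c then tc' else 0, ?_,
    h _ _ ?_ ?_ ?_ ?_ ?_ ?_⟩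
  · intro x h1 h2 h3
    simp [h1, h2, h3]
  all_goals simp [hab.symm, hac.symm, hbc.symm]

theorem trianglePairs_swap (s : A → ℤˣ) (δ : ℤˣ) {a b c : A} (hab : a ≠ b) (hac : a ≠ c)
    (hbc : b ≠ c) : ∀ p ∈ trianglePairs s δ a b c,
      omega3Perm a b c p.1 = p.2 ∧ omega3Perm a b c p.2 = p.1 := by
  obtain ⟨e₁, e₂, e₃, e₄, e₅, e₆⟩ := omega3Perm_apply hab hac hbc
  have : ∀ (t : ℤˣ) (x y : A × Bool), omega3Perm a b c x = y → omega3Perm a b c y = x →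
      omega3Perm a b c (orient t x y).1 = (orient t x y).2 ∧
        omega3Perm a b c (orient t x y).2 = (orient t x y).1 := by
    intro t x y hx hy
    rcases Int.units_eq_one_or t with rfl | rfl
    · rw [orient_one]; exact ⟨hx, hy⟩
    · rw [orient_neg_one]; exact ⟨hy, hx⟩
  simp only [trianglePairs, List.mem_cons, List.not_mem_nil, or_false, forall_eq_or_imp, forall_eq]
  exact ⟨this _ _ _ e₁ e₂, this _ _ _ e₃ e₄, this _ _ _ e₅ e₆⟩

theorem trianglePairs_nodup (s : A → ℤˣ) (δ : ℤˣ) {a b c : A} (hab : a ≠ b) (hac : a ≠ c)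
    (hbc : b ≠ c) : ((trianglePairs s δ a b c).map Prod.fst ++
      (trianglePairs s δ a b c).map Prod.snd).Nodup := by
  unfold trianglePairs
  rcases Int.units_eq_one_or (δ * s a * s b * s c) with h1 | h1 <;>
  rcases Int.units_eq_one_or (δ * s a) with h2 | h2 <;>
  rcases Int.units_eq_one_or (δ * s b) with h3 | h3 <;>
  rw [h1, h2, h3] <;>
  simp [orient_one, orient_neg_one, hab, hac, hbc, hab.symm, hac.symm, hbc.symm]

theorem mem_trianglePairs (s : A → ℤˣ) (δ : ℤˣ) {a b c : A} {e : A × Bool}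
    (he : e.1 = a ∨ e.1 = b ∨ e.1 = c) : e ∈ (trianglePairs s δ a b c).map Prod.fst ∨
      e ∈ (trianglePairs s δ a b c).map Prod.snd := by
  unfold trianglePairs
  rw [← List.mem_append]
  obtain ⟨x, β⟩ := e
  rcases Int.units_eq_one_or (δ * s a * s b * s c) with h1 | h1 <;>
  rcases Int.units_eq_one_or (δ * s a) with h2 | h2 <;>
  rcases Int.units_eq_one_or (δ * s b) with h3 | h3 <;>
  rw [h1, h2, h3] <;>
  rcases he with rfl | rfl | rfl <;> cases β <;>
  simp [orient_one, orient_neg_one]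

theorem next_permute {D : GaussDiagram n} {i : Fin n} {e f : D.Arrow × Bool} (h : D.Next i e f)
    (τ : Equiv.Perm (D.Arrow × Bool)) : (D.permute τ).Next i (τ e) (τ f) := by
  obtain ⟨l, hl⟩ := h
  exact ⟨l.map τ, hl.map τ⟩

/-- The permutation moves only endpoints of lifted arrows of `A`, so it commutes with reading
letters and fixes the endpoints of all marks, in particular the last circle. -/
theorem Realizes.permute_omega3 {s : A → ℤˣ} {w : Fin n → List (Letter A)}
    {L : GaussDiagram (n + 1)} {φ : L.Arrow → A ⊕ ℤˣ} (h : Realizes L ⟨A, s, w⟩ φ) {a b c : A}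
    (hab : a ≠ b) (hac : a ≠ c) (hbc : b ≠ c) :
    Realizes (L.permute (omega3Perm (h.lift a) (h.lift b) (h.lift c)))
      ⟨A, s, fun i => (w i).map (Sum.map (omega3Perm a b c) id)⟩ φ := by
  obtain ⟨e₁, e₂, e₃, e₄, e₅, e₆⟩ := omega3Perm_apply hab hac hbc
  obtain ⟨f₁, f₂, f₃, f₄, f₅, f₆⟩ := omega3Perm_apply (h.lift_injective.ne hab)
    (h.lift_injective.ne hac) (h.lift_injective.ne hbc)
  have hl : ∀ x β, readLetter φ (h.lift x, β) = Sum.inl (x, β) := fun x β =>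
    h.readLetter_eq_inl_iff.mpr rfl
  have hfix : ∀ e : L.Arrow × Bool, e.1 ≠ h.lift a → e.1 ≠ h.lift b → e.1 ≠ h.lift c →
      omega3Perm (h.lift a) (h.lift b) (h.lift c) e = e := fun e ha hb hc =>
    omega3Perm_apply_of_ne ha hb hc e.2
  have hread : ∀ e, readLetter φ (omega3Perm (h.lift a) (h.lift b) (h.lift c) e) =
      Sum.map (omega3Perm a b c) id (readLetter φ e) := by
    rintro ⟨x, β⟩
    by_cases ha : x = h.lift a
    · subst ha; cases β <;> simp [hl, e₁, e₃, f₁, f₃]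
    by_cases hb : x = h.lift b
    · subst hb; cases β <;> simp [hl, e₂, e₅, f₂, f₅]
    by_cases hc : x = h.lift c
    · subst hc; cases β <;> simp [hl, e₄, e₆, f₄, f₆]
    rw [hfix _ ha hb hc]
    rw [h.eq_lift_iff] at ha hb hc
    rcases hx : φ x with y | y
    · rw [hx] at ha hb hc
      have h1 : readLetter φ (x, β) = Sum.inl (y, β) := readLetter_eq_inl.mpr ⟨hx, rfl⟩
      rw [h1, Sum.map_inl, omega3Perm_apply_of_ne]
      · rintro rfl; exact ha rfl
      · rintro rfl; exact hb rfl
      · rintro rfl; exact hc rfl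
    · have h1 : readLetter φ (x, β) = Sum.inr y := readLetter_eq_inr.mpr hx
      rw [h1]; rfl
  have hmark : ∀ e : L.Arrow × Bool, (φ e.1).isRight = true →
      omega3Perm (h.lift a) (h.lift b) (h.lift c) e = e := by
    intro e he
    apply hfix <;> rintro hx <;> rw [hx, h.map_lift] at he <;> simp at he
  refine ⟨h.bij, h.sign, fun e => ?_, fun i => ?_⟩
  · constructor
    · intro he
      obtain ⟨e', he', rfl⟩ := List.mem_map.mp he
      have := (h.last e').mp he'
      rw [hmark e' this.2]
      exact this
    · intro he
      exact List.mem_map.mpr ⟨e, (h.last e).mpr he, hmark e he.2⟩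
  · change ((L.word i.castSucc).map _).map (readLetter φ) ~r _
    have h1 := (h.word i).map (Sum.map (omega3Perm a b c) id)
    rw [List.map_map] at h1 ⊢
    refine (isRotated_of_eq (List.map_congr_left fun e _ => ?_)).trans h1
    exact hread e

/-- With the inner arcs free of marks the move can be made in the realization. As the outer labels
are preserved, the result is the canonical word of the new diagram for `t'`, opened along the
reversed pairs. -/
theorem canon_sw_of_omega3 {D D' : GaussDiagram n} (h : D.Omega3 D') :
    (canon D fun _ => 0).Sw (canon D' fun _ => 0) := by
  obtain ⟨a, b, c, δ, hab, hac, hbc, h1, h2, h3, hiso⟩ := h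
  refine Marked.Sw.trans ?_ (canon_sw_of_iso hiso).symm
  change Marked.Sw _ (canon (D.permute (omega3Perm a b c)) _)
  obtain ⟨t, t', htt', ht⟩ := exists_triangle_labels D.sign δ hab hac hbc
  have hswap := trianglePairs_swap D.sign δ hab hac hbc
  have hnd := trianglePairs_nodup D.sign δ hab hac hbc
  have hmem := fun e => mem_trianglePairs D.sign δ (a := a) (b := b) (c := c) (e := e)
  rw [consecutive_iff] at h1 h2 h3
  have hnext : ∀ p ∈ trianglePairs D.sign δ a b c, ∃ i, D.Next i p.1 p.2 := by
    simp only [trianglePairs, List.mem_cons, List.not_mem_nil, or_false, forall_eq_or_imp,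
      forall_eq]
    exact ⟨h1, h2, h3⟩
  rw [List.nodup_append] at hnd
  have hop := canon_sw_openBlock D t _ hnd.1 hnd.2.1 hnext fun p hp => (ht p hp).1
  refine (canon_sw_canon D _ t).trans (hop.trans ?_)
  obtain ⟨L, φ, hL⟩ := Marked.exists_realizes (hop.1.mp (canon_wf D t))
  have hcons : ∀ (s : ℤˣ) (e f : D.Arrow × Bool),
      orient s e f ∈ trianglePairs D.sign δ a b c →
      L.Consecutive s (hL.liftEnd e) (hL.liftEnd f) := by
    intro s e f hp
    obtain ⟨i, hi⟩ := hnext _ hp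
    have := hL.next_of_mem (e := (orient s e f).1) (f := (orient s e f).2) hp hi
    refine (consecutive_iff ..).mpr ⟨i.castSucc, ?_⟩
    rcases Int.units_eq_one_or s with rfl | rfl
    · simpa only [orient_one] using this
    · simpa only [orient_neg_one] using this
  have hsg : ∀ x, L.sign (hL.lift x) = D.sign x := fun x => by
    rw [hL.sign, hL.map_lift]; rfl
  refine (Marked.Sw.of_realizes hL (hL.permute_omega3 hab hac hbc) (SemiWelded.of_move (Move.omega3
    ⟨hL.lift a, hL.lift b, hL.lift c, δ, hL.lift_injective.ne hab, hL.lift_injective.ne hac,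
      hL.lift_injective.ne hbc, ?_, ?_, ?_, Iso.refl _⟩))).trans ?_
  · rw [hsg, hsg, hsg]; exact hcons _ (tail a) (tail b) (by simp [trianglePairs])
  · rw [hsg]; exact hcons _ (head a) (tail c) (by simp [trianglePairs])
  · rw [hsg]; exact hcons _ (head b) (head c) (by simp [trianglePairs])
  have hps₁ : ((trianglePairs D.sign δ a b c).map Prod.swap).map Prod.fst =
      (trianglePairs D.sign δ a b c).map Prod.snd := by
    rw [List.map_map]; rfl
  have hps₂ : ((trianglePairs D.sign δ a b c).map Prod.swap).map Prod.snd =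
      (trianglePairs D.sign δ a b c).map Prod.fst := by
    rw [List.map_map]; rfl
  have hop' := canon_sw_openBlock (D.permute (omega3Perm a b c)) t'
    ((trianglePairs D.sign δ a b c).map Prod.swap)
    ((congrArg List.Nodup hps₁).mpr hnd.2.1) ((congrArg List.Nodup hps₂).mpr hnd.1)
    (by
      intro p hp
      obtain ⟨q, hq, rfl⟩ := List.mem_map.mp hp
      obtain ⟨i, hi⟩ := hnext q hq
      have := next_permute hi (omega3Perm a b c)
      rw [(hswap q hq).1, (hswap q hq).2] at this
      exact ⟨i, this⟩)
    (by
      intro p hp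
      obtain ⟨q, hq, rfl⟩ := List.mem_map.mp hp
      exact (ht q hq).2.2.2)
  refine Marked.Sw.trans ?_ (hop'.symm.trans (canon_sw_canon _ _ _))
  -- The two opened words are equal letter by letter, so no further cancellation is needed.
  refine Marked.sw_of_red_eq D.sign fun i => congrArg red ?_
  change _ = ((D.word i).map (omega3Perm a b c)).flatMap (openBlock (A := D.Arrow) D.sign t'
    ((trianglePairs D.sign δ a b c).map Prod.swap))
  rw [List.map_flatMap, List.flatMap_map]
  refine List.flatMap_congr fun e _ => ?_
  have hrun : ∀ k, (run D.Arrow k).map (Sum.map (omega3Perm a b c) id) = run D.Arrow k :=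
    fun k => by simp [run]
  have hdisj : ∀ e, e ∈ (trianglePairs D.sign δ a b c).map Prod.fst →
      e ∉ (trianglePairs D.sign δ a b c).map Prod.snd := fun e h1 h2 => hnd.2.2 e h1 e h2 rfl
  unfold openBlock
  rw [hps₁, hps₂]
  by_cases he : e.1 = a ∨ e.1 = b ∨ e.1 = c
  · rcases hmem e he with he | he
    · obtain ⟨p, hp, rfl⟩ := List.mem_map.mp he
      have hs : p.2 ∈ (trianglePairs D.sign δ a b c).map Prod.snd := List.mem_map_of_mem hp
      rw [(hswap p hp).1, dropIf_pos he, dropIf_neg (hdisj _ he), dropIf_pos hs,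
        dropIf_neg fun h => hdisj _ h hs, (ht p hp).2.1]
      simp [hrun, (hswap p hp).1]
    · obtain ⟨p, hp, rfl⟩ := List.mem_map.mp he
      have hs : p.1 ∈ (trianglePairs D.sign δ a b c).map Prod.fst := List.mem_map_of_mem hp
      rw [(hswap p hp).2, dropIf_pos he, dropIf_neg fun h => hdisj _ h he, dropIf_pos hs,
        dropIf_neg (hdisj _ hs), (ht p hp).2.2.1]
      simp [hrun, (hswap p hp).2]
  · have hfst : ∀ p ∈ trianglePairs D.sign δ a b c, (p.1.1 = a ∨ p.1.1 = b ∨ p.1.1 = c) ∧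
        (p.2.1 = a ∨ p.2.1 = b ∨ p.2.1 = c) := by
      have : ∀ (s : ℤˣ) (x y : D.Arrow × Bool), (x.1 = a ∨ x.1 = b ∨ x.1 = c) →
          (y.1 = a ∨ y.1 = b ∨ y.1 = c) →
          ((orient s x y).1.1 = a ∨ (orient s x y).1.1 = b ∨ (orient s x y).1.1 = c) ∧
          ((orient s x y).2.1 = a ∨ (orient s x y).2.1 = b ∨ (orient s x y).2.1 = c) := by
        intro s x y hx hy
        rcases Int.units_eq_one_or s with rfl | rfl
        · rw [orient_one]; exact ⟨hx, hy⟩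
        · rw [orient_neg_one]; exact ⟨hy, hx⟩
      simp only [trianglePairs, List.mem_cons, List.not_mem_nil, or_false, forall_eq_or_imp,
        forall_eq]
      exact ⟨this _ _ _ (by simp) (by simp), this _ _ _ (by simp) (by simp),
        this _ _ _ (by simp) (by simp)⟩
    have n1 : e ∉ (trianglePairs D.sign δ a b c).map Prod.fst := fun h => by
      obtain ⟨p, hp, rfl⟩ := List.mem_map.mp h
      exact he (hfst p hp).1
    have n2 : e ∉ (trianglePairs D.sign δ a b c).map Prod.snd := fun h => by
      obtain ⟨p, hp, rfl⟩ := List.mem_map.mp h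
      exact he (hfst p hp).2
    push Not at he
    have hfix : omega3Perm a b c e = e := omega3Perm_apply_of_ne he.1 he.2.1 he.2.2 e.2
    have h1 : inLabel D.sign t' e = inLabel D.sign t e := by
      simp [inLabel, htt' _ he.1 he.2.1 he.2.2]
    have h2 : outLabel D.sign t' e = outLabel D.sign t e := by
      simp [outLabel, htt' _ he.1 he.2.1 he.2.2]
    rw [hfix, dropIf_neg n1, dropIf_neg n2, dropIf_neg n1, dropIf_neg n2, h1, h2]
    simp [hrun, hfix]

end ThirdMove

theorem canon_sw_of_equivalent {D D' : GaussDiagram n} (h : D.Equivalent D') :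
    (canon D fun _ => 0).Sw (canon D' fun _ => 0) := by
  induction h with
  | rel D D' h =>
    cases h with
    | iso h => exact canon_sw_of_iso h
    | omega1 h => exact canon_sw_of_omega1 h
    | omega2 h => exact canon_sw_of_omega2 h
    | omega3 h => exact canon_sw_of_omega3 h
  | refl D => exact Marked.Sw.refl _
  | symm _ _ _ ih => exact ih.symm
  | trans _ _ _ _ _ ih ih' => exact ih.trans ih'

/-! ### Alexander systems -/

section Alexander

/-- Carry μ^label from left to right through the word: a mark is absorbed into the exponent, and an
endpoint e satisfies μ^in(e) · e = (canonical block of e) · μ^out(e). -/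
theorem markPow_mul_red {A : Type} (s : A → ℤˣ) (t : A → ℤ) (w : List (Letter A)) (l : ℕ → ℤ)
    (hend : ∀ j e, w[j]? = some (Sum.inl e) → l j = inLabel s t e ∧ l (j + 1) = outLabel s t e)
    (hmark : ∀ j (u : ℤˣ), w[j]? = some (Sum.inr u) → l (j + 1) = l j + u) :
    markPow A (l 0) * red w =
      red (w.flatMap (Sum.elim (canonBlock s t) fun _ => [])) * markPow A (l w.length) := by
  induction w generalizing l with
  | nil => simp
  | cons x w ih =>
    have h := ih (fun j => l (j + 1)) (fun j e he => hend (j + 1) e (by simpa using he))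
      (fun j u hu => hmark (j + 1) u (by simpa using hu))
    rw [red_cons, List.length_cons, List.flatMap_cons, red_append, mul_assoc _ _ (markPow _ _),
      ← h]
    rcases x with e | u
    · obtain ⟨h1, h2⟩ := hend 0 e rfl
      rw [Sum.elim_inl, red_canonBlock, h1, zero_add, h2]
      simp [mul_assoc]
    · rw [Sum.elim_inr, red_nil, one_mul, red_mark, markPow_mul_assoc, ← hmark 0 u rfl]

/-- In terms of the incoming over-label t, the rule reads the same for both signs ε: the over-strand
goes from t to t - ε and the under-strand from t - ε to t. -/
theorem exists_label {L : GaussDiagram (n + 1)} {Γ : L.BaseArc → ℤ} (h : L.IsSubNumbering Γ)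
    {a : L.Arrow} (ha : ¬L.Touches a) : ∃ t : ℤ,
      (∀ p (hp : p.1 ≠ Fin.last n), L.endpoint p = tail a →
        Γ (L.baseBefore p hp) = t ∧ Γ (L.baseAfter p hp) = t - L.sign a) ∧
      ∀ q (hq : q.1 ≠ Fin.last n), L.endpoint q = head a →
        Γ (L.baseBefore q hq) = t - L.sign a ∧ Γ (L.baseAfter q hq) = t := by
  have hpos : ∀ b, ∃ p : L.Position, p.1 ≠ Fin.last n ∧ L.endpoint p = (a, b) := by
    intro b
    obtain ⟨i, hi, -⟩ := L.unique (a, b)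
    obtain ⟨j, hj⟩ := List.mem_iff_get.mp hi
    refine ⟨⟨i, j⟩, ?_, hj⟩
    rintro (rfl : i = Fin.last n)
    cases b
    · exact ha (Or.inr hi)
    · exact ha (Or.inl hi)
  obtain ⟨p₀, hp₀, hp₀'⟩ := hpos true
  obtain ⟨q₀, hq₀, hq₀'⟩ := hpos false
  -- An arbitrary position `p` of the tail is compared with `p₀` by pairing both with `q₀`, which
  -- forces the same integer `m`.
  refine ⟨Γ (L.baseBefore p₀ hp₀), fun p hp hp' => ?_, fun q hq hq' => ?_⟩ <;>
  rcases Int.units_eq_one_or (L.sign a) with hs | hs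
  · obtain ⟨m, h1, h2, h3, h4⟩ := h.pos a p q₀ hp hq₀ hs hp' hq₀'
    obtain ⟨m', h1', h2', h3', h4'⟩ := h.pos a p₀ q₀ hp₀ hq₀ hs hp₀' hq₀'
    simp only [hs, Units.val_one]
    omega
  · obtain ⟨m, h1, h2, h3, h4⟩ := h.neg a p q₀ hp hq₀ hs hp' hq₀'
    obtain ⟨m', h1', h2', h3', h4'⟩ := h.neg a p₀ q₀ hp₀ hq₀ hs hp₀' hq₀'
    simp only [hs, Units.val_neg, Units.val_one]
    omega
  · obtain ⟨m, h1, h2, h3, h4⟩ := h.pos a p₀ q hp₀ hq hs hp₀' hq'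
    simp only [hs, Units.val_one]
    omega
  · obtain ⟨m, h1, h2, h3, h4⟩ := h.neg a p₀ q hp₀ hq hs hp₀' hq'
    simp only [hs, Units.val_neg, Units.val_one]
    omega

open Classical in
/-- Crossings with the last component are marks. -/
noncomputable def baseMeaning (L : GaussDiagram (n + 1)) (x : L.Arrow) :
    {a // ¬L.Touches a} ⊕ ℤˣ :=
  if h : L.Touches x then Sum.inr (L.sign x) else Sum.inl ⟨x, h⟩

theorem baseMeaning_of_touches {L : GaussDiagram (n + 1)} {x : L.Arrow} (h : L.Touches x) :
    L.baseMeaning x = Sum.inr (L.sign x) := dif_pos h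

theorem baseMeaning_of_not {L : GaussDiagram (n + 1)} {x : L.Arrow} (h : ¬L.Touches x) :
    L.baseMeaning x = Sum.inl ⟨x, h⟩ := dif_neg h

theorem baseMeaning_eq_inl {L : GaussDiagram (n + 1)} {x : L.Arrow} {a : {a // ¬L.Touches a}} :
    L.baseMeaning x = Sum.inl a ↔ x = a := by
  by_cases h : L.Touches x
  · rw [baseMeaning_of_touches h]
    simp only [reduceCtorEq, false_iff]
    rintro rfl
    exact a.2 h
  · rw [baseMeaning_of_not h]
    simp [Subtype.ext_iff]

theorem baseMeaning_eq_inr {L : GaussDiagram (n + 1)} {x : L.Arrow} {u : ℤˣ} :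
    L.baseMeaning x = Sum.inr u ↔ L.Touches x ∧ L.sign x = u := by
  by_cases h : L.Touches x
  · simp [baseMeaning_of_touches h, h]
  · simp [baseMeaning_of_not h, h]

theorem realizes_baseMeaning {L : GaussDiagram (n + 1)} (hL : ∀ a, L.Touches a →
    tail a ∈ L.word (Fin.last n) ∧ head a ∉ L.word (Fin.last n)) :
    Realizes L ⟨{a // ¬L.Touches a}, fun a => L.sign a,
      fun i => (L.word i.castSucc).map (readLetter L.baseMeaning)⟩ L.baseMeaning where
  bij a := ⟨a, baseMeaning_eq_inl.mpr rfl, fun _ hx => baseMeaning_eq_inl.mp hx⟩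
  sign x := by
    by_cases h : L.Touches x
    · rw [baseMeaning_of_touches h]; rfl
    · rw [baseMeaning_of_not h]; rfl
  last e := by
    obtain ⟨x, b⟩ := e
    have hr : (L.baseMeaning x).isRight = true ↔ L.Touches x := by
      by_cases h : L.Touches x
      · simp [baseMeaning_of_touches h, h]
      · simp [baseMeaning_of_not h, h]
    rw [hr]
    constructor
    · intro h
      cases b
      · exact absurd h (hL x (Or.inr h)).2
      · exact ⟨rfl, Or.inl h⟩
    · rintro ⟨hb, h⟩
      obtain rfl : b = true := hb
      exact (hL x h).1
  word i := List.IsRotated.refl _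

/-- The labels met along a component. -/
def labelAt (L : GaussDiagram (n + 1)) (Γ : L.BaseArc → ℤ) (i : Fin n) (j : ℕ) : ℤ :=
  Γ ⟨⟨i.castSucc, ⟨j % max (L.word i.castSucc).length 1,
    Nat.mod_lt _ (lt_max_of_lt_right one_pos)⟩⟩, (Fin.castSucc_lt_last i).ne⟩

/-- The label returns to its initial value after one turn around the circle. This also covers a
circle without endpoints, which is one short arc. -/
theorem labelAt_length (L : GaussDiagram (n + 1)) (Γ : L.BaseArc → ℤ) (i : Fin n) :
    L.labelAt Γ i (L.word i.castSucc).length = L.labelAt Γ i 0 := by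
  have h : (L.word i.castSucc).length % max (L.word i.castSucc).length 1 =
      0 % max (L.word i.castSucc).length 1 := by
    rcases Nat.eq_zero_or_pos (L.word i.castSucc).length with h | h
    · simp [h]
    · rw [max_eq_left h]; simp
  simp only [labelAt, h]

theorem labelAt_eq_before {L : GaussDiagram (n + 1)} (Γ : L.BaseArc → ℤ) (i : Fin n)
    (j : Fin (L.word i.castSucc).length) : L.labelAt Γ i j =
      Γ (L.baseBefore ⟨i.castSucc, j⟩ (Fin.castSucc_lt_last i).ne) := by
  have h : (j : ℕ) % max (L.word i.castSucc).length 1 = j :=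
    Nat.mod_eq_of_lt (lt_max_of_lt_left j.isLt)
  simp only [labelAt, h]
  rfl

theorem labelAt_succ_eq_after {L : GaussDiagram (n + 1)} (Γ : L.BaseArc → ℤ) (i : Fin n)
    (j : Fin (L.word i.castSucc).length) : L.labelAt Γ i (j + 1) =
      Γ (L.baseAfter ⟨i.castSucc, j⟩ (Fin.castSucc_lt_last i).ne) := by
  have h : max (L.word i.castSucc).length 1 = (L.word i.castSucc).length :=
    max_eq_left (Nat.zero_lt_of_lt j.isLt)
  have h' : ((j : ℕ) + 1) % max (L.word i.castSucc).length 1 =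
      (j + 1) % (L.word i.castSucc).length := by rw [h]
  simp only [labelAt, h']
  rfl

theorem AlexanderSystem.exists_realizes {D : GaussDiagram n} (S : D.AlexanderSystem) :
    ∃ M φ, Realizes S.diagram M φ ∧ M.Sw (canon D fun _ => 0) := by
  obtain ⟨L, hbase, hL, Γ, hΓ⟩ := S
  refine ⟨_, _, realizes_baseMeaning hL, Marked.Sw.trans ?_ (canon_sw_of_iso hbase)⟩
  choose t ht₁ ht₂ using fun a : {a // ¬L.Touches a} => exists_label hΓ a.2
  refine Marked.Sw.trans ?_ (canon_sw_canon L.eraseLast t _)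
  -- The conjugating exponent on each circle is the label at its base point, the initial value in
  -- `markPow_mul_red`.
  refine Marked.sw_of_red_conj _ (fun i => L.labelAt Γ i 0) fun i => ?_
  have hget : ∀ (j : ℕ) (x : Letter {a // ¬L.Touches a}),
      ((L.word i.castSucc).map (readLetter L.baseMeaning))[j]? = some x →
      ∃ k : Fin (L.word i.castSucc).length, (k : ℕ) = j ∧
        readLetter L.baseMeaning (L.endpoint ⟨i.castSucc, k⟩) = x := by
    intro j x hx
    obtain ⟨hj, hx⟩ := List.getElem?_eq_some_iff.mp hx
    rw [List.getElem_map] at hx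
    exact ⟨⟨j, by simpa using hj⟩, rfl, hx⟩
  have key := markPow_mul_red (fun a : {a // ¬L.Touches a} => L.sign a) t
    ((L.word i.castSucc).map (readLetter L.baseMeaning)) (L.labelAt Γ i) ?_ ?_
  · rw [List.length_map, labelAt_length] at key
    rw [key]
    congr 2
    rw [List.flatMap_map]
    refine (flatMap_keep (canonBlock (fun a : {a // ¬L.Touches a} => L.sign a) t) ?_ ?_ _).symm
    · intro e he
      have : readLetter L.baseMeaning e = Sum.inl (⟨e.1, he⟩, e.2) :=
        readLetter_eq_inl.mpr ⟨baseMeaning_of_not he, rfl⟩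
      rw [this]; rfl
    · intro e he
      have : readLetter L.baseMeaning e = Sum.inr (L.sign e.1) :=
        readLetter_eq_inr.mpr (baseMeaning_of_touches (not_not.mp he))
      rw [this]; rfl
  · rintro j ⟨a, b⟩ hj
    obtain ⟨k, rfl, hk⟩ := hget j _ hj
    rw [readLetter_eq_inl, baseMeaning_eq_inl] at hk
    have hk' : L.endpoint ⟨i.castSucc, k⟩ = (a.1, b) := Prod.ext hk.1 hk.2
    rw [labelAt_eq_before, labelAt_succ_eq_after]
    cases b
    · exact ht₂ a _ _ hk'
    · exact ht₁ a _ _ hk'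
  · intro j u hj
    obtain ⟨k, rfl, hk⟩ := hget j _ hj
    rw [readLetter_eq_inr, baseMeaning_eq_inr] at hk
    obtain ⟨hk, rfl⟩ := hk
    rw [labelAt_eq_before, labelAt_succ_eq_after]
    refine hΓ.mixed _ _ _ (hL _ hk).1 ?_
    refine Prod.ext rfl ?_
    refine (realizes_baseMeaning hL).head_of_mark (i := i) (List.get_mem ..) ?_
    rw [baseMeaning_of_touches hk]; rfl

end Alexander

/-! ### The Zh-construction -/

section Zh

theorem reverseLast_sign_of_tail {L : GaussDiagram (n + 1)} {a : L.Arrow}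
    (h₁ : tail a ∈ L.word (Fin.last n)) (h₂ : head a ∉ L.word (Fin.last n)) :
    L.reverseLast.sign a = -L.sign a := by
  simp [reverseLast, h₁, h₂]

theorem reverseLast_sign_of_not {L : GaussDiagram (n + 1)} {a : L.Arrow}
    (h₁ : tail a ∉ L.word (Fin.last n)) (h₂ : head a ∉ L.word (Fin.last n)) :
    L.reverseLast.sign a = L.sign a := by
  simp [reverseLast, h₁, h₂]

theorem zhOp_word_castSucc (D : GaussDiagram n) (c : ZhChoice D) (i : Fin n) :
    (D.zhOp c).word i.castSucc = (D.word i).flatMap (D.zhLocal c.onRight) := by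
  refine (if_neg (Fin.castSucc_lt_last i).ne).trans ?_
  simp only [zh, Fin.snoc_castSucc]
  rfl

theorem zh_word_last (D : GaussDiagram n) (c : ZhChoice D) :
    (D.zh c).word (Fin.last n) = c.order.map fun e => tail (Sum.inr e) := by
  simp only [zh, Fin.snoc_last]

theorem mem_zh_word_last (D : GaussDiagram n) (c : ZhChoice D)
    (x : (D.Arrow ⊕ D.Arrow × Bool) × Bool) :
    x ∈ (D.zh c).word (Fin.last n) ↔ x.2 = true ∧ x.1.isRight = true := by
  rw [zh_word_last]
  refine List.mem_map.trans ⟨?_, ?_⟩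
  · rintro ⟨e, -, rfl⟩
    exact ⟨rfl, rfl⟩
  · obtain ⟨a | e, b⟩ := x
    · exact fun h => absurd h.2 (by simp)
    · rintro ⟨rfl, -⟩
      exact ⟨e, c.complete e, rfl⟩

/-- The meaning of the arrows of the Zh-diagram. -/
def zhMeaning (D : GaussDiagram n) : D.Arrow ⊕ D.Arrow × Bool → D.Arrow ⊕ ℤˣ :=
  Sum.map id fun e => if e.2 = true then D.sign e.1 else -D.sign e.1

open Classical in
/-- The labels of the incoming over-strands in the Zh-diagram. -/
noncomputable def zhLabel (D : GaussDiagram n) (c : ZhChoice D) (a : D.Arrow) : ℤ :=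
  if D.sign a = 1 ↔ c.onRight a = true then 0 else D.sign a

/-- `zhLabel` gives label 0 to the two arcs on the side not chosen, so that the canonical block has
a single mark, on the chosen side. Its sign is that of the added crossing after reversal of `ω`. -/
theorem map_zhLocal (D : GaussDiagram n) (c : ZhChoice D) (e : D.Arrow × Bool) :
    (D.zhLocal c.onRight e).map (readLetter D.zhMeaning) =
      canonBlock D.sign (D.zhLabel c) e := by
  obtain ⟨a, b⟩ := e
  have h1 : ∀ b, readLetter D.zhMeaning (Sum.inl a, b) = Sum.inl (a, b) := fun b => rfl
  have h2 : ∀ e, readLetter D.zhMeaning (head (Sum.inr e)) =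
    Sum.inr (if e.2 = true then D.sign e.1 else -D.sign e.1) := fun e => rfl
  have h3 : run D.Arrow 1 = [Sum.inr 1] := rfl
  have h4 : run D.Arrow (-1) = [Sum.inr (-1)] := rfl
  have h5 : (-1 : ℤˣ) ≠ 1 := by decide
  rcases Int.units_eq_one_or (D.sign a) with h | h <;> cases h' : c.onRight a <;> cases b <;>
    simp [zhLocal, LeftToRight, h1, h2, canonBlock, inLabel, outLabel, zhLabel, h, h', h3, h4, h5]

theorem zhOp_realizes (D : GaussDiagram n) (c : ZhChoice D) :
    Realizes (D.zhOp c) (canon D (D.zhLabel c)) (D.zhMeaning : _ → D.Arrow ⊕ ℤˣ) where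
  bij a := by
    refine ⟨(Sum.inl a : D.Arrow ⊕ D.Arrow × Bool), rfl, ?_⟩
    rintro (x | x) hx
    · exact congrArg Sum.inl (Sum.inl_injective hx)
    · cases hx
  sign := by
    rintro (a | e)
    · refine reverseLast_sign_of_not (L := D.zh c) (a := Sum.inl a) ?_ ?_ <;>
        refine (mem_zh_word_last D c _).not.mpr ?_ <;> simp
    · refine (reverseLast_sign_of_tail (L := D.zh c) (a := Sum.inr e)
        ((mem_zh_word_last D c _).mpr ⟨rfl, rfl⟩) ((mem_zh_word_last D c _).not.mpr ?_)).trans ?_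
      · simp
      · change -(if e.2 = true then -D.sign e.1 else D.sign e.1) =
          if e.2 = true then D.sign e.1 else -D.sign e.1
        split_ifs <;> simp
  last := fun (e : (D.Arrow ⊕ D.Arrow × Bool) × Bool) => by
    have h1 : (D.zhOp c).word (Fin.last n) = ((D.zh c).word (Fin.last n)).reverse := if_pos rfl
    rw [h1]
    refine List.mem_reverse.trans ((mem_zh_word_last D c e).trans ?_)
    rcases e.1 with x | x <;> rfl
  word i := by
    rw [zhOp_word_castSucc]
    refine isRotated_of_eq ((List.map_flatMap ..).trans ?_)
    exact List.flatMap_congr fun e _ => map_zhLocal D c e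

end Zh

end GaussDiagram

theorem theorem1p1 {n : ℕ} (D₀ D₁ : GaussDiagram n) (h : D₀.Equivalent D₁) :
    (∀ (A : D₁.AlexanderSystem) (c : D₀.ZhChoice), A.diagram.SemiWelded (D₀.zhOp c)) ∧
    (∀ A B : D₁.AlexanderSystem, A.diagram.SemiWelded B.diagram) := by
  refine ⟨fun A c => ?_, fun A B => ?_⟩
  · obtain ⟨M, φ, hA, hM⟩ := A.exists_realizes
    exact (hM.trans ((GaussDiagram.canon_sw_of_equivalent h).symm.trans
      (GaussDiagram.canon_sw_canon ..))).2 _ _ _ _ hA (D₀.zhOp_realizes c)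
  · obtain ⟨M, φ, hA, hM⟩ := A.exists_realizes
    obtain ⟨M', φ', hB, hM'⟩ := B.exists_realizes
    exact (hM.trans hM'.symm).2 _ _ _ _ hA hB
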